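/- Let $0<q<1$, $\kappa=-2\pi/\ln q>0$, $(a;q)_n=\prod_{j=0}^{n-1}(1-aq^j)$, $(a;q)_\infty=\prod_{j\ge0}(1-aq^j)$ and $\theta(x)=\sum_{n\in\mathbb Z}q^{n(n-1)/2}x^n$. Let $\tilde{\mathbb C}^*$ be the Riemann surface of the logarithm, identified with $]0,\infty[\times\mathbb R$ by $x=|x|e^{i\arg x}$, on which $\log x=\ln|x|+i\arg x$ and $x^a=e^{a\log x}$ for $a\in\mathbb C$. For $a<b$ let $S(a,b)=\{x\in\tilde{\mathbb C}^*: a<\arg x<b\}$. For $x\in\tilde{\mathbb C}^*$ let $x^*=x^{-\kappa i}\in\tilde{\mathbb C}^*$, that is, $\log x^*=-\kappa i\log x$. Let $\mu,\nu\in\mathbb C$ be such that $\operatorname{Re}(\mu+\nu)>0$ and $q^\mu\notin q^{\mathbb Z}$. Then for every $d\in(0,2\pi)$ the Laplace integral $$I_\nu^{[d]}(q^\mu;q,x)=\int_0^{\infty e^{id}}\frac{\theta(-q^\mu/t)}{(1/t;q)_\infty}\,e^{-xt}\,t^\nu\,\frac{dt}{t}$$ (taken along the half-line $\arg t=d$)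 converges absolutely for all $x\in S(-d-\frac\pi2,-d+\frac\pi2)$, and there is a (unique) analytic function $I_\nu(q^\mu;q,\cdot)$ on $S(-\frac{5\pi}2,\frac\pi2)$ that coincides with $I_\nu^{[d]}(q^\mu;q,\cdot)$ on $S(-d-\frac\pi2,-d+\frac\pi2)$ for every $d\in(0,2\pi)$. Moreover, for all $x\in S(-\frac{5\pi}2,\frac\pi2)$, $$I_\nu(q^\mu;q,x)=C(q,\mu)\Bigl(\frac1x\Bigr)^{\nu}\sum_{n\ge0}\frac{q^{n(n+1)/2}}{(q;q)_n}\,\Phi(n+\nu,\mu;q,x^*)\Bigl(-\frac1x\Bigr)^n,$$ where $$C(q,\mu)=\frac{\kappa\,(q^\mu;q)_\infty\,(q^{1-\mu};q)_\infty}{i\,(q;q)_\infty},\qquad \Phi(u,\mu;q,z)=z^{-\frac{\mu i}{\kappa}}\sum_{\ell\in\mathbb Z}\frac{\Gamma(u+\mu+\kappa i\ell)}{1-e^{2\pi i(\mu+\kappa i\ell)}}\,z^\ell ,$$ and the series over $n$, as well as each of the series over $\ell$ that define $\Phi(n+\nu,\mu;q,x^*)$, converge absolutely. -/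

import Mathlib

open MeasureTheory

noncomputable section

namespace QLaplace

/-- The Riemann surface of the complex logarithm: points are pairs (modulus, argument) with
positive modulus and arbitrary real argument. -/
@[ext] structure LogSurface where
  modulus : ℝ
  arg : ℝ
  modulus_pos : 0 < modulus

namespace LogSurface

/-- The logarithm, a bijection of the surface onto `ℂ` (its global chart). -/
def log (x : LogSurface) : ℂ := (Real.log x.modulus : ℂ) + (x.arg : ℂ) * Complex.I

/-- The inverse of `log`. -/
def ofLog (w : ℂ) : LogSurface := ⟨Real.exp w.re, w.im, Real.exp_pos _⟩

theorem log_ofLog (w : ℂ) : (ofLog w).log = w := by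
  simp [log, ofLog, Complex.re_add_im]

theorem ofLog_log (x : LogSurface) : ofLog x.log = x := by
  ext
  · simp [log, ofLog, Real.exp_log x.modulus_pos]
  · simp [log, ofLog]

/-- The projection to the punctured complex plane, `x ↦ |x| e^{i arg x}`. -/
def toComplex (x : LogSurface) : ℂ := Complex.exp x.log

/-- The complex power `x ^ a = e^{a log x}`. -/
def cpow (x : LogSurface) (a : ℂ) : ℂ := Complex.exp (a * x.log)

/-- The inverse `1 / x` on the surface. -/
def inv (x : LogSurface) : LogSurface := ⟨x.modulus⁻¹, -x.arg, inv_pos.mpr x.modulus_pos⟩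

/-- The open sector `S(a, b)`. -/
def sector (a b : ℝ) : Set LogSurface := {x | a < x.arg ∧ x.arg < b}

end LogSurface

/-- The infinite `q`-shifted factorial `(a; q)_∞ = ∏_{j ≥ 0} (1 - a q^j)`. -/
def qPochInf (a : ℂ) (q : ℝ) : ℂ := ∏' j : ℕ, (1 - a * (q : ℂ) ^ j)

/-- The finite `q`-shifted factorial `(a; q)_n`. -/
def qPoch (a : ℂ) (q : ℝ) (n : ℕ) : ℂ := ∏ j ∈ Finset.range n, (1 - a * (q : ℂ) ^ j)

/-- The Jacobi theta function `θ(q, x) = ∑_{n ∈ ℤ} q^{n(n-1)/2} x^n`; the integer division in the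
exponent is exact. -/
def theta (q : ℝ) (x : ℂ) : ℂ := ∑' n : ℤ, (q : ℂ) ^ (n * (n - 1) / 2) * x ^ n

/-- `κ = -2π / ln q`. -/
def kappa (q : ℝ) : ℝ := -(2 * Real.pi) / Real.log q

/-- The modular variable `x* = x^{-κ i}`, as a point of the surface of the logarithm. -/
def modularVar (q : ℝ) (x : LogSurface) : LogSurface :=
  LogSurface.ofLog (-((kappa q : ℂ) * Complex.I) * x.log)

/-- The general term, of index `l ∈ ℤ`, of the Laurent series in the definition of `Φ`. -/
def PhiTerm (u mu : ℂ) (q : ℝ) (z : LogSurface) (l : ℤ) : ℂ :=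
  Complex.Gamma (u + mu + (kappa q : ℂ) * Complex.I * (l : ℂ)) /
    (1 - Complex.exp (2 * (Real.pi : ℂ) * Complex.I *
      (mu + (kappa q : ℂ) * Complex.I * (l : ℂ)))) * z.toComplex ^ l

/-- `Φ(u, μ; q, z) = z^{-μ i / κ} ∑_{l ∈ ℤ} Γ(u + μ + κ i l) / (1 - e^{2π i (μ + κ i l)}) z^l`. -/
def Phi (u mu : ℂ) (q : ℝ) (z : LogSurface) : ℂ :=
  z.cpow (-(mu * Complex.I) / (kappa q : ℂ)) * ∑' l : ℤ, PhiTerm u mu q z l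

/-- The integrand `θ(-α/t) / (1/t; q)_∞ · e^{-xt} · t^ν / t` of the Laplace integral at the point
`t = s e^{id}` of the half-line of direction `d`, multiplied by `dt/ds = t/s`. -/
def laplaceIntegrand (q : ℝ) (nu a : ℂ) (d : ℝ) (x : LogSurface) (s : ℝ) : ℂ :=
  let t : ℂ := (s : ℂ) * Complex.exp ((d : ℂ) * Complex.I)
  theta q (-a / t) / qPochInf (1 / t) q * Complex.exp (-x.toComplex * t) *
    Complex.exp (nu * ((Real.log s : ℂ) + (d : ℂ) * Complex.I)) / (s : ℂ)

/-- The Laplace integral `I_ν^{[d]}(α; q, x)` along the half-line from `0` to `∞ e^{id}`. -/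
def laplaceDir (q : ℝ) (nu a : ℂ) (d : ℝ) (x : LogSurface) : ℂ :=
  ∫ s in Set.Ioi (0 : ℝ), laplaceIntegrand q nu a d x s

/-- The direction `(π - 2 arg x) / 3`. For `x` in `S(-5π/2, π/2)` it lies in `(0, 2π)`, and `x` lies
in the sector `S(-d - π/2, -d + π/2)` attached to this direction `d`. -/
def directionOf (x : LogSurface) : ℝ := (Real.pi - 2 * x.arg) / 3

theorem directionOf_spec {x : LogSurface}
    (hx : x ∈ LogSurface.sector (-(5 * Real.pi / 2)) (Real.pi / 2)) :
    directionOf x ∈ Set.Ioo 0 (2 * Real.pi) ∧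
      x ∈ LogSurface.sector (-directionOf x - Real.pi / 2) (-directionOf x + Real.pi / 2) := by
  obtain ⟨h1, h2⟩ := hx
  refine ⟨⟨?_, ?_⟩, ?_, ?_⟩ <;> simp only [directionOf] <;> linarith

/-- The function `I_ν(α; q, x)` on the sector `S(-5π/2, π/2)`: the value at `x` is the Laplace
integral `I_ν^{[d]}(α; q, x)` along one direction `d ∈ (0, 2π)` with `x ∈ S(-d - π/2, -d + π/2)`.
That every such direction gives the same value and that the function obtained is analytic, so that
it is the common analytic continuation of the `I_ν^{[d]}`, is part of the theorem. -/
def laplaceI (q : ℝ) (nu a : ℂ) (x : LogSurface) : ℂ := laplaceDir q nu a (directionOf x) x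

/-- `C(q, μ) = κ (q^μ; q)_∞ (q^{1-μ}; q)_∞ / (i (q; q)_∞)`. -/
def connectionConst (q : ℝ) (mu : ℂ) : ℂ :=
  (kappa q : ℂ) * (qPochInf ((q : ℂ) ^ mu) q * qPochInf ((q : ℂ) ^ (1 - mu)) q) /
    (Complex.I * qPochInf (q : ℂ) q)

/-- The general term, of index `n`, of the expansion of `I_ν` at infinity. -/
def expansionTerm (q : ℝ) (mu nu : ℂ) (x : LogSurface) (n : ℕ) : ℂ :=
  (q : ℂ) ^ (n * (n + 1) / 2) / qPoch (q : ℂ) q n *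
    Phi ((n : ℂ) + nu) mu q (modularVar q x) * (-1 / x.toComplex) ^ n

end QLaplace

end

/-!
Write `t = e ^ w` with `0 < Im w < 2π`, `κ = -2π / ln q`, `α = q ^ μ`, and let `r = e ^ (-2πκ)` be
the base dual to `q`. By the triple product (`theta_neg_eq`), the kernel
`θ(-α / t) / (1 / t; q)_∞` is `θ(-α / t) / θ(-1 / t)` times `(q; q)_∞ (q t; q)_∞`. The theta
quotient is multiplied by `α` under `t ↦ q t`, so `t ^ (-μ)` times it should be a Laurent series in
`z = t ^ {κi}`. This series is found without contour integrals:

* Jacobi's imaginary transformation, available through `jacobiTheta₂_functional_equation`, turns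
  the quotient into a constant times `t ^ μ θ_r(-A z) / θ_r(-z)`, where `A = e ^ {2πiμ}`
  (`theta_ratio_modular`);
* in the annulus `r < |z| < 1`, the product of `S(z) = ∑ z ^ l / (1 - A r ^ l)` and `θ_r(-z)` is
  proportional to `θ_r(-A z)` (`exists_kroneckerSeries_mul_theta`): its Laurent coefficients
  satisfy the recurrence that characterizes the coefficients of a theta series up to a constant.
  The triple product is proved by the same device;
* the remaining constant comes from the simple poles of both sides at `t = 1`
  (`theta_div_qPochInf`).

With Euler's expansion of `(q t; q)_∞`, the integrand becomes a double series over `ℕ × ℤ` of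
multiples of `t ^ {n + ν + μ + κil} e ^ {-xt} / t`. On a half-line of direction `d ∈ (0, 2π)` the
`L¹` norms of its terms are summable: over `l` because `|z| = e ^ {-κd}` lies in the annulus,
over `n` because the factor `q ^ {n(n+1)/2}` beats `Γ(n + σ)`. Integrating term by term gives
absolute convergence of the integral and its expansion together
(`integrableOn_and_hasSum_laplace`); no asymptotics of `Γ` on vertical lines are needed. Each term
is a Gamma integral, whose value does not depend on `d`, so the integrals along different
directions agree wherever both converge. Holomorphy follows by differentiating under the integral
along one fixed direction.
-/

open MeasureTheory Filter Topology

noncomputable section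

namespace QLaplace

/-! ### Series over the integers -/

lemma two_mul_triangle (n : ℤ) : 2 * (n * (n - 1) / 2) = n * (n - 1) :=
  Int.mul_ediv_cancel' (Int.even_mul_pred_self n).two_dvd

lemma triangle_succ (n : ℤ) : (n + 1) * (n + 1 - 1) / 2 = n * (n - 1) / 2 + n := by
  linarith [two_mul_triangle n, two_mul_triangle (n + 1)]

lemma triangle_add (m n : ℤ) :
    (m + n) * (m + n - 1) / 2 = m * (m - 1) / 2 + n * (n - 1) / 2 + m * n := by
  linarith [two_mul_triangle m, two_mul_triangle n, two_mul_triangle (m + n)]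

lemma triangle_nonneg (n : ℤ) : 0 ≤ n * (n - 1) / 2 := by
  have h : 0 ≤ n * (n - 1) := by
    rcases le_or_gt n 0 with h | h <;> nlinarith
  omega

/-- A sequence over `ℤ` with `X (k + 1) = b r ^ k X k` is a multiple of the coefficients
of a theta series. -/
lemma eq_triangle_of_recurrence {r b : ℂ} (hr : r ≠ 0) (hb : b ≠ 0) {X : ℤ → ℂ}
    (hX : ∀ k, X (k + 1) = b * r ^ k * X k) (k : ℤ) :
    X k = X 0 * (r ^ (k * (k - 1) / 2) * b ^ k) := by
  have step : ∀ k : ℤ, r ^ ((k + 1) * (k + 1 - 1) / 2) * b ^ (k + 1) =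
      b * r ^ k * (r ^ (k * (k - 1) / 2) * b ^ k) := by
    intro k
    rw [triangle_succ, zpow_add₀ hr, zpow_add_one₀ hb]; ring
  induction k using Int.induction_on with
  | zero => simp
  | succ i ih => rw [hX, ih, step]; ring
  | pred i ih =>
    have h1 := hX (-(i : ℤ) - 1)
    have h2 := step (-(i : ℤ) - 1)
    rw [sub_add_cancel] at h1 h2
    rw [h1, h2] at ih
    have h0 : b * r ^ (-(i : ℤ) - 1) ≠ 0 := mul_ne_zero hb (zpow_ne_zero _ hr)
    apply mul_left_cancel₀ h0
    rw [ih]; ring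

/-- The Cauchy product of two absolutely convergent series indexed by `ℤ`. -/
lemma hasSum_int_convolution {f g : ℤ → ℂ} (hf : Summable f) (hg : Summable g) :
    HasSum (fun k => ∑' m, f m * g (k - m)) ((∑' m, f m) * ∑' m, g m) := by
  have h1 : Summable fun p : ℤ × ℤ => f p.1 * g p.2 :=
    summable_mul_of_summable_norm hf.norm hg.norm
  have h2 : HasSum (fun p : ℤ × ℤ => f p.1 * g p.2) ((∑' m, f m) * ∑' m, g m) := by
    rw [tsum_mul_tsum_of_summable_norm hf.norm hg.norm]
    exact h1.hasSum
  let e : ℤ × ℤ ≃ ℤ × ℤ :=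
    { toFun := fun p => (p.2, p.1 - p.2)
      invFun := fun p => (p.1 + p.2, p.1)
      left_inv := fun p => by ext <;> simp
      right_inv := fun p => by ext <;> simp }
  have h3 := (e.hasSum_iff).2 h2
  exact h3.prod_fiberwise fun k => (h3.summable.prod_factor k).hasSum

lemma exists_norm_le_of_tendsto {u : ℕ → ℂ} {a : ℂ} (h : Tendsto u atTop (𝓝 a)) :
    ∃ M : ℝ, ∀ n, ‖u n‖ ≤ M := by
  obtain ⟨M, hM⟩ := (Metric.isBounded_range_of_tendsto u h).exists_norm_le
  exact ⟨M, fun n => hM _ ⟨n, rfl⟩⟩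

/-! ### The theta series -/

section Theta

variable {q : ℝ}

/-- In the variable `log x`, the series `θ(x)` is Mathlib's two-variable Jacobi theta series. -/
lemma theta_term_eq (hq0 : 0 < q) (y : ℂ) (n : ℤ) :
    (q : ℂ) ^ (n * (n - 1) / 2) * Complex.exp y ^ n =
      jacobiTheta₂_term n ((y - Real.log q / 2) / (2 * Real.pi * Complex.I))
        (Real.log q / (2 * Real.pi * Complex.I)) := by
  have hpi : (Real.pi : ℂ) ≠ 0 := by exact_mod_cast Real.pi_ne_zero
  have hq : (q : ℂ) = Complex.exp (Real.log q) := by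
    rw [← Complex.ofReal_exp, Real.exp_log hq0]
  rw [jacobiTheta₂_term, hq, ← Complex.exp_int_mul, ← Complex.exp_int_mul, ← Complex.exp_add]
  congr 1
  have h : (2 : ℂ) * ((n * (n - 1) / 2 : ℤ) : ℂ) = n * (n - 1) := by
    exact_mod_cast two_mul_triangle n
  have hI := Complex.I_ne_zero
  field_simp
  linear_combination (Real.log q : ℂ) * h

lemma jacobi_parameter_im_pos (hq0 : 0 < q) (hq1 : q < 1) :
    0 < ((Real.log q : ℂ) / (2 * Real.pi * Complex.I)).im := by
  have h : (Real.log q : ℂ) / (2 * Real.pi * Complex.I) =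
      ((-Real.log q / (2 * Real.pi) : ℝ) : ℂ) * Complex.I := by
    have hpi : (Real.pi : ℂ) ≠ 0 := by exact_mod_cast Real.pi_ne_zero
    have hI := Complex.I_ne_zero
    push_cast
    field_simp
    simp
  rw [h]
  have := Real.log_neg hq0 hq1
  simp only [Complex.mul_im, Complex.ofReal_re, Complex.I_im, Complex.ofReal_im, Complex.I_re]
  simp only [mul_one, mul_zero, add_zero]
  have := Real.pi_pos
  apply div_pos <;> linarith

lemma theta_exp_eq (hq0 : 0 < q) (y : ℂ) :
    theta q (Complex.exp y) =
      jacobiTheta₂ ((y - Real.log q / 2) / (2 * Real.pi * Complex.I))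
        (Real.log q / (2 * Real.pi * Complex.I)) := by
  rw [theta, jacobiTheta₂]
  exact tsum_congr fun n => theta_term_eq hq0 y n

lemma summable_theta (hq0 : 0 < q) (hq1 : q < 1) {x : ℂ} (hx : x ≠ 0) :
    Summable fun n : ℤ => (q : ℂ) ^ (n * (n - 1) / 2) * x ^ n := by
  have h := (summable_jacobiTheta₂_term_iff ((Complex.log x - Real.log q / 2) /
    (2 * Real.pi * Complex.I)) _).2 (jacobi_parameter_im_pos hq0 hq1)
  refine h.congr fun n => ?_
  rw [← theta_term_eq hq0, Complex.exp_log hx]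

/-- The terms of index `n` and `1 - n` of `θ(-1)` cancel. -/
lemma theta_neg_one (q : ℝ) : theta q (-1) = 0 := by
  have h : theta q (-1) = -theta q (-1) := by
    conv_lhs => rw [theta, ← (Equiv.subLeft (1 : ℤ)).tsum_eq]
    rw [theta, ← tsum_neg]
    refine tsum_congr fun n => ?_
    have h1 : (1 - n) * (1 - n - 1) = n * (n - 1) := by ring
    have h2 : (-1 : ℂ) ^ (1 - n) = -(-1 : ℂ) ^ n := by
      rw [zpow_sub₀ (by norm_num), zpow_one, div_eq_mul_inv, ← inv_zpow]; norm_num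
    simp only [Equiv.subLeft_apply, h1, h2, mul_neg]
  exact self_eq_neg.mp h

end Theta

/-! ### Euler's expansion and the triple product -/

section Euler

variable {q : ℝ}

lemma one_sub_pow_ne_zero (hq0 : 0 < q) (hq1 : q < 1) {n : ℕ} (hn : n ≠ 0) :
    (1 : ℂ) - (q : ℂ) ^ n ≠ 0 := by
  have := pow_lt_one₀ hq0.le hq1 hn
  rw [sub_ne_zero]
  exact_mod_cast this.ne'

lemma qPoch_self_ne_zero (hq0 : 0 < q) (hq1 : q < 1) (n : ℕ) : qPoch (q : ℂ) q n ≠ 0 := by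
  rw [qPoch, Finset.prod_ne_zero_iff]
  intro j _
  rw [← pow_succ']
  exact one_sub_pow_ne_zero hq0 hq1 j.succ_ne_zero

lemma summable_qPoch_factor (hq0 : 0 < q) (hq1 : q < 1) (x : ℂ) :
    Summable fun j : ℕ => ‖-(x * (q : ℂ) ^ j)‖ := by
  simp only [norm_neg, norm_mul, norm_pow, Complex.norm_real, Real.norm_eq_abs, abs_of_pos hq0]
  exact (summable_geometric_of_lt_one hq0.le hq1).mul_left _

lemma tendsto_qPoch (hq0 : 0 < q) (hq1 : q < 1) (x : ℂ) :
    Tendsto (qPoch x q) atTop (𝓝 (qPochInf x q)) := by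
  have h := multipliable_one_add_of_summable (summable_qPoch_factor hq0 hq1 x)
  simp only [← sub_eq_add_neg] at h
  exact h.hasProd.tendsto_prod_nat

lemma qPochInf_ne_zero (hq0 : 0 < q) (hq1 : q < 1) {x : ℂ} (hx : ∀ j : ℕ, x * (q : ℂ) ^ j ≠ 1) :
    qPochInf x q ≠ 0 := by
  have h := tprod_one_add_ne_zero_of_summable (f := fun j : ℕ => -(x * (q : ℂ) ^ j))
    (fun j => by rw [← sub_eq_add_neg, sub_ne_zero]; exact (hx j).symm)
    (summable_qPoch_factor hq0 hq1 x)
  simp only [← sub_eq_add_neg] at h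
  exact h

lemma qPochInf_self_ne_zero (hq0 : 0 < q) (hq1 : q < 1) : qPochInf (q : ℂ) q ≠ 0 := by
  refine qPochInf_ne_zero hq0 hq1 fun j => ?_
  rw [← pow_succ']
  exact fun h => one_sub_pow_ne_zero hq0 hq1 j.succ_ne_zero (by rw [h, sub_self])

lemma qPochInf_eq_mul (hq0 : 0 < q) (hq1 : q < 1) (x : ℂ) :
    qPochInf x q = (1 - x) * qPochInf (q * x) q := by
  have h1 := (tendsto_qPoch hq0 hq1 x).comp (tendsto_add_atTop_nat 1)
  have h2 := (tendsto_qPoch hq0 hq1 (q * x)).const_mul (1 - x)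
  refine tendsto_nhds_unique h1 (h2.congr fun n => ?_)
  simp only [Function.comp, qPoch, Finset.prod_range_succ', pow_zero, mul_one]
  rw [mul_comm]
  congr 1
  exact Finset.prod_congr rfl fun j _ => by rw [pow_succ]; ring

/-- The reciprocal `1 / (q; q)_n`, extended by `0` to negative `n`, as its value
`(q ^ (n + 1); q)_∞ / (q; q)_∞` demands. -/
def invPoch (q : ℝ) (n : ℤ) : ℂ := if 0 ≤ n then (qPoch (q : ℂ) q n.toNat)⁻¹ else 0

/-- The coefficient of `x ^ n` in Euler's expansion of `(x; q)_∞`, for `n ∈ ℤ`; it is `0` for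
negative `n`. -/
def eulerCoeff (q : ℝ) (n : ℤ) : ℂ := (q : ℂ) ^ (n * (n - 1) / 2) * (-1) ^ n * invPoch q n

lemma invPoch_natCast (n : ℕ) : invPoch q n = (qPoch (q : ℂ) q n)⁻¹ := by
  simp [invPoch]

lemma invPoch_of_neg {n : ℤ} (hn : n < 0) : invPoch q n = 0 := if_neg (not_le.2 hn)

lemma eulerCoeff_of_neg {n : ℤ} (hn : n < 0) : eulerCoeff q n = 0 := by
  rw [eulerCoeff, invPoch_of_neg hn, mul_zero]

lemma eulerCoeff_zero : eulerCoeff q 0 = 1 := by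
  simp [eulerCoeff, invPoch, qPoch]

lemma invPoch_succ (hq0 : 0 < q) (hq1 : q < 1) (n : ℤ) :
    (1 - (q : ℂ) ^ (n + 1)) * invPoch q (n + 1) = invPoch q n := by
  rcases lt_trichotomy n (-1) with h | rfl | h
  · rw [invPoch_of_neg (by omega), invPoch_of_neg (by omega), mul_zero]
  · simp [invPoch]
  · lift n to ℕ using by omega
    have h1 := invPoch_natCast (q := q) (n + 1)
    have h3 : qPoch (q : ℂ) q (n + 1) = qPoch (q : ℂ) q n * (1 - (q : ℂ) ^ (n + 1)) := by
      rw [qPoch, qPoch, Finset.prod_range_succ, ← pow_succ']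
    have h4 := one_sub_pow_ne_zero hq0 hq1 n.succ_ne_zero
    have h5 := qPoch_self_ne_zero hq0 hq1 n
    rw [invPoch_natCast]
    push_cast at h1
    rw [h1, h3]
    have : (q : ℂ) ^ ((n : ℤ) + 1) = (q : ℂ) ^ (n + 1) := by norm_cast
    rw [this]
    field_simp

lemma eulerCoeff_succ (hq0 : 0 < q) (hq1 : q < 1) (n : ℤ) :
    (1 - (q : ℂ) ^ (n + 1)) * eulerCoeff q (n + 1) = -(q : ℂ) ^ n * eulerCoeff q n := by
  have hq : (q : ℂ) ≠ 0 := by exact_mod_cast hq0.ne'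
  rw [eulerCoeff, eulerCoeff, triangle_succ, zpow_add₀ hq _ n, zpow_add_one₀ (a := (-1 : ℂ)) (by norm_num) n]
  linear_combination (-((q : ℂ) ^ (n * (n - 1) / 2) * (q : ℂ) ^ n * (-1) ^ n)) *
    invPoch_succ hq0 hq1 n

lemma exists_invPoch_bound (hq0 : 0 < q) (hq1 : q < 1) : ∃ M : ℝ, ∀ n, ‖invPoch q n‖ ≤ M := by
  obtain ⟨M, hM⟩ := exists_norm_le_of_tendsto
    ((tendsto_qPoch hq0 hq1 q).inv₀ (qPochInf_self_ne_zero hq0 hq1))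
  refine ⟨M, fun n => ?_⟩
  rcases lt_or_ge n 0 with h | h
  · rw [invPoch_of_neg h, norm_zero]
    exact (norm_nonneg _).trans (hM 0)
  · lift n to ℕ using h
    rw [invPoch_natCast]
    exact hM n

lemma summable_eulerCoeff (hq0 : 0 < q) (hq1 : q < 1) {x : ℂ} (hx : x ≠ 0) :
    Summable fun n => eulerCoeff q n * x ^ n := by
  obtain ⟨M, hM⟩ := exists_invPoch_bound hq0 hq1
  refine Summable.of_norm_bounded ((summable_theta hq0 hq1 hx).norm.mul_left M) fun n => ?_
  rw [eulerCoeff, norm_mul, norm_mul, norm_mul, norm_zpow (-1 : ℂ), norm_neg, norm_one, one_zpow,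
    mul_one, norm_mul]
  have := mul_le_mul_of_nonneg_right (hM n)
    (mul_nonneg (norm_nonneg ((q : ℂ) ^ (n * (n - 1) / 2))) (norm_nonneg (x ^ n)))
  linarith

lemma euler_series_eq_mul (hq0 : 0 < q) (hq1 : q < 1) {x : ℂ} (hx : x ≠ 0) :
    ∑' n, eulerCoeff q n * x ^ n = (1 - x) * ∑' n, eulerCoeff q n * (x * q) ^ n := by
  have hq : (q : ℂ) ≠ 0 := by exact_mod_cast hq0.ne'
  have h1 := summable_eulerCoeff hq0 hq1 hx
  have h2 := summable_eulerCoeff hq0 hq1 (mul_ne_zero hx hq)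
  have h3 : ∑' n, (eulerCoeff q n * x ^ n - eulerCoeff q n * (x * q) ^ n) =
      ∑' n, (-x) * (eulerCoeff q n * (x * q) ^ n) := by
    rw [← (Equiv.addRight (1 : ℤ)).tsum_eq]
    refine tsum_congr fun n => ?_
    have := eulerCoeff_succ hq0 hq1 n
    simp only [Equiv.coe_addRight, mul_zpow, zpow_add_one₀ hx, zpow_add_one₀ hq] at this ⊢
    linear_combination (x ^ n * x) * this
  rw [h1.tsum_sub h2, tsum_mul_left] at h3
  linear_combination h3

/-- Euler's expansion of `(x; q)_∞`. -/
lemma qPochInf_eq_tsum (hq0 : 0 < q) (hq1 : q < 1) {x : ℂ} (hx : x ≠ 0) :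
    qPochInf x q = ∑' n, eulerCoeff q n * x ^ n := by
  have hq : (q : ℂ) ≠ 0 := by exact_mod_cast hq0.ne'
  have key : ∀ N : ℕ, ∑' n, eulerCoeff q n * x ^ n =
      qPoch x q N * ∑' n, eulerCoeff q n * (x * (q : ℂ) ^ N) ^ n := by
    intro N
    induction N with
    | zero => simp [qPoch]
    | succ N ih =>
      rw [ih, euler_series_eq_mul hq0 hq1 (mul_ne_zero hx (pow_ne_zero N hq)), qPoch, qPoch,
        Finset.prod_range_succ, pow_succ]
      simp only [mul_assoc]
  have hlim : Tendsto (fun N : ℕ => ∑' n, eulerCoeff q n * (x * (q : ℂ) ^ N) ^ n) atTop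
      (𝓝 (∑' n : ℤ, if n = 0 then 1 else 0)) := by
    refine tendsto_tsum_of_dominated_convergence (summable_eulerCoeff hq0 hq1 hx).norm
      (fun n => ?_) (Eventually.of_forall fun N n => ?_)
    · rcases lt_trichotomy n 0 with h | rfl | h
      · simp [eulerCoeff_of_neg h, h.ne]
      · simp [eulerCoeff_zero]
      · lift n to ℕ using h.le
        have hn : n ≠ 0 := by omega
        have h1 : Tendsto (fun N : ℕ => (x * (q : ℂ) ^ N) ^ n) atTop (𝓝 ((x * 0) ^ n)) := by
          refine ((tendsto_pow_atTop_nhds_zero_of_norm_lt_one ?_).const_mul x).pow n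
          simpa [abs_of_pos hq0] using hq1
        have h2 := h1.const_mul (eulerCoeff q n)
        simpa [hn] using h2
    · rcases lt_or_ge n 0 with h | h
      · simp [eulerCoeff_of_neg h]
      · lift n to ℕ using h
        simp only [norm_mul, zpow_natCast, norm_pow, Complex.norm_real, Real.norm_eq_abs,
          abs_of_pos hq0]
        gcongr
        exact mul_le_of_le_one_right (norm_nonneg x) (pow_le_one₀ hq0.le hq1.le)
  rw [tsum_ite_eq] at hlim
  have h := (tendsto_qPoch hq0 hq1 x).mul hlim
  rw [mul_one] at h
  exact tendsto_nhds_unique h (tendsto_const_nhds.congr key)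

lemma exists_eulerCoeff_bound (hq0 : 0 < q) (hq1 : q < 1) : ∃ M : ℝ, ∀ n, ‖eulerCoeff q n‖ ≤ M := by
  have h := (summable_eulerCoeff hq0 hq1 (one_ne_zero)).norm
  simp only [one_zpow, mul_one] at h
  exact ⟨_, fun n => h.le_tsum n fun _ _ => norm_nonneg _⟩

/-- The coefficient of `x ^ k` in the Laurent series of `(x; q)_∞ (q / x; q)_∞`. -/
def tripleCoeff (q : ℝ) (k : ℤ) : ℂ :=
  ∑' m, eulerCoeff q m * (eulerCoeff q (m - k) * (q : ℂ) ^ (m - k))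

lemma hasSum_tripleCoeff (hq0 : 0 < q) (hq1 : q < 1) {x : ℂ} (hx : x ≠ 0) :
    HasSum (fun k => tripleCoeff q k * x ^ k) (qPochInf x q * qPochInf (q / x) q) := by
  have hq : (q : ℂ) ≠ 0 := by exact_mod_cast hq0.ne'
  have hg : Summable fun m : ℤ => eulerCoeff q (-m) * ((q : ℂ) / x) ^ (-m) :=
    (Equiv.neg ℤ).summable_iff.2 (summable_eulerCoeff hq0 hq1 (div_ne_zero hq hx))
  have h := hasSum_int_convolution (summable_eulerCoeff hq0 hq1 hx) hg
  have h2 : ∑' m : ℤ, eulerCoeff q (-m) * ((q : ℂ) / x) ^ (-m) = qPochInf (q / x) q := by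
    rw [qPochInf_eq_tsum hq0 hq1 (div_ne_zero hq hx), ← (Equiv.neg ℤ).tsum_eq]
    exact tsum_congr fun m => by rw [Equiv.neg_apply, neg_neg]
  rw [h2, ← qPochInf_eq_tsum hq0 hq1 hx] at h
  have h3 : (fun k => tripleCoeff q k * x ^ k) = fun k => ∑' m, eulerCoeff q m * x ^ m *
      (eulerCoeff q (-(k - m)) * ((q : ℂ) / x) ^ (-(k - m))) := by
    ext k
    rw [tripleCoeff, ← tsum_mul_right]
    refine tsum_congr fun m => ?_
    have h4 : x ^ m = x ^ k * x ^ (m - k) := by rw [← zpow_add₀ hx]; congr 1; ring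
    rw [neg_sub, div_zpow, h4]
    have := zpow_ne_zero (m - k) hx
    field_simp
  rw [h3]
  exact h

lemma summable_tripleCoeff (hq0 : 0 < q) (hq1 : q < 1) {y : ℂ} (hy : y ≠ 0) (k : ℤ) :
    Summable fun m : ℤ => eulerCoeff q m * (eulerCoeff q (m - k) * y ^ (m - k)) := by
  obtain ⟨B, hB⟩ := exists_eulerCoeff_bound hq0 hq1
  have h1 : Summable fun m : ℤ => eulerCoeff q (m - k) * y ^ (m - k) := by
    simpa only [Function.comp_def, Equiv.subRight_apply] using
      (summable_eulerCoeff hq0 hq1 hy).comp_injective (Equiv.subRight k).injective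
  refine Summable.of_norm_bounded (h1.norm.mul_left B) fun m => ?_
  rw [norm_mul]
  exact mul_le_mul_of_nonneg_right (hB m) (norm_nonneg _)

lemma tripleCoeff_succ (hq0 : 0 < q) (hq1 : q < 1) (k : ℤ) :
    tripleCoeff q (k + 1) = -1 * (q : ℂ) ^ k * tripleCoeff q k := by
  have hq : (q : ℂ) ≠ 0 := by exact_mod_cast hq0.ne'
  -- `U` is the sum defining `tripleCoeff q k` with `q ^ 2` in place of `q`
  set U := ∑' m, eulerCoeff q m * (eulerCoeff q (m - k) * ((q : ℂ) * q) ^ (m - k)) with hU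
  have h1 : ∑' m, eulerCoeff q m * (1 - (q : ℂ) ^ m) *
      (eulerCoeff q (m - (k + 1)) * (q : ℂ) ^ (m - (k + 1))) = -(q : ℂ) ^ k * U := by
    rw [hU, ← (Equiv.addRight (1 : ℤ)).tsum_eq, ← tsum_mul_left]
    refine tsum_congr fun m => ?_
    have h := eulerCoeff_succ hq0 hq1 m
    have h3 : m + 1 - (k + 1) = m - k := by ring
    have h4 : (q : ℂ) ^ m = (q : ℂ) ^ k * (q : ℂ) ^ (m - k) := by
      rw [← zpow_add₀ hq]; congr 1; ring
    rw [Equiv.coe_addRight, h3, mul_zpow]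
    linear_combination (eulerCoeff q (m - k) * (q : ℂ) ^ (m - k)) * h -
      eulerCoeff q m * eulerCoeff q (m - k) * (q : ℂ) ^ (m - k) * h4
  have h2 : ∑' m, eulerCoeff q m * (q : ℂ) ^ m *
      (eulerCoeff q (m - (k + 1)) * (q : ℂ) ^ (m - (k + 1))) =
      -(q : ℂ) ^ k * (tripleCoeff q k - U) := by
    rw [hU, tripleCoeff, ← (summable_tripleCoeff hq0 hq1 hq k).tsum_sub
      (summable_tripleCoeff hq0 hq1 (mul_ne_zero hq hq) k), ← tsum_mul_left]
    refine tsum_congr fun m => ?_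
    have h := eulerCoeff_succ hq0 hq1 (m - (k + 1))
    have h3 : m - (k + 1) + 1 = m - k := by ring
    have h4 : (q : ℂ) ^ m = (q : ℂ) ^ k * (q : ℂ) ^ (m - k) := by
      rw [← zpow_add₀ hq]; congr 1; ring
    rw [h3] at h
    rw [mul_zpow]
    linear_combination (eulerCoeff q m * (q : ℂ) ^ m) * h -
      eulerCoeff q m * eulerCoeff q (m - k) * (1 - (q : ℂ) ^ (m - k)) * h4
  have s := summable_tripleCoeff hq0 hq1 hq (k + 1)
  obtain ⟨B, hB⟩ := exists_eulerCoeff_bound hq0 hq1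
  have s2 : Summable fun m => eulerCoeff q m * (q : ℂ) ^ m *
      (eulerCoeff q (m - (k + 1)) * (q : ℂ) ^ (m - (k + 1))) := by
    refine ((summable_tripleCoeff hq0 hq1 (mul_ne_zero hq hq) (k + 1)).mul_left
      ((q : ℂ) ^ (k + 1))).congr fun m => ?_
    have h4 : (q : ℂ) ^ m = (q : ℂ) ^ (k + 1) * (q : ℂ) ^ (m - (k + 1)) := by
      rw [← zpow_add₀ hq]; congr 1; ring
    rw [mul_zpow, h4]; ring
  have h5 := s.tsum_sub s2
  rw [h2] at h5
  have h6 : ∀ m, eulerCoeff q m * (eulerCoeff q (m - (k + 1)) * (q : ℂ) ^ (m - (k + 1))) -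
      eulerCoeff q m * (q : ℂ) ^ m * (eulerCoeff q (m - (k + 1)) * (q : ℂ) ^ (m - (k + 1))) =
      eulerCoeff q m * (1 - (q : ℂ) ^ m) *
      (eulerCoeff q (m - (k + 1)) * (q : ℂ) ^ (m - (k + 1))) := fun m => by ring
  rw [tsum_congr h6, h1] at h5
  rw [tripleCoeff]
  linear_combination -h5

/-- The constant term is read off from the coefficient of index `k → ∞`. -/
lemma tripleCoeff_zero (hq0 : 0 < q) (hq1 : q < 1) :
    tripleCoeff q 0 = (qPochInf (q : ℂ) q)⁻¹ := by
  have hq : (q : ℂ) ≠ 0 := by exact_mod_cast hq0.ne'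
  obtain ⟨M, hM⟩ := exists_invPoch_bound hq0 hq1
  have hM0 : 0 ≤ M := (norm_nonneg _).trans (hM 0)
  let F : ℕ → ℤ → ℂ := fun k j => invPoch q (j + k) *
    ((q : ℂ) ^ (j * (j - 1) / 2) * (-1) ^ j * ((q : ℂ) ^ k) ^ j) * (eulerCoeff q j * (q : ℂ) ^ j)
  have key : ∀ k : ℕ, tripleCoeff q 0 = ∑' j, F k j := by
    intro k
    have h1 := eq_triangle_of_recurrence hq (by norm_num) (tripleCoeff_succ hq0 hq1) k
    have h0 : (q : ℂ) ^ ((k : ℤ) * (k - 1) / 2) * (-1) ^ (k : ℤ) ≠ 0 :=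
      mul_ne_zero (zpow_ne_zero _ hq) (zpow_ne_zero _ (by norm_num))
    apply mul_right_cancel₀ h0
    rw [← h1, tripleCoeff, ← (Equiv.addRight (k : ℤ)).tsum_eq, ← tsum_mul_right]
    refine tsum_congr fun j => ?_
    simp only [F, Equiv.coe_addRight, add_sub_cancel_right]
    rw [eulerCoeff, triangle_add, zpow_add₀ hq, zpow_add₀ hq, zpow_add₀ (by norm_num),
      ← zpow_natCast, ← zpow_mul, mul_comm j (k : ℤ)]
    ring
  have hlim : Tendsto (fun k => ∑' j, F k j) atTop
      (𝓝 (∑' j : ℤ, if j = 0 then (qPochInf (q : ℂ) q)⁻¹ else 0)) := by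
    refine tendsto_tsum_of_dominated_convergence
      ((summable_eulerCoeff hq0 hq1 hq).norm.mul_left M)
      (fun j => ?_) (Eventually.of_forall fun k j => ?_)
    · have hu : Tendsto (fun k : ℕ => invPoch q k) atTop (𝓝 (qPochInf (q : ℂ) q)⁻¹) := by
        simp only [invPoch_natCast]
        exact (tendsto_qPoch hq0 hq1 q).inv₀ (qPochInf_self_ne_zero hq0 hq1)
      rcases lt_trichotomy j 0 with h | rfl | h
      · simp [F, eulerCoeff_of_neg h, h.ne]
      · simpa [F, eulerCoeff_zero] using hu
      · lift j to ℕ using h.le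
        have hj : j ≠ 0 := by omega
        have h1 : Tendsto (fun k : ℕ => ((q : ℂ) ^ k) ^ j) atTop (𝓝 (0 ^ j)) := by
          refine (tendsto_pow_atTop_nhds_zero_of_norm_lt_one ?_).pow j
          simpa [abs_of_pos hq0] using hq1
        have h2 : Tendsto (fun k : ℕ => invPoch q (j + k)) atTop (𝓝 (qPochInf (q : ℂ) q)⁻¹) := by
          refine (hu.comp (tendsto_add_atTop_nat j)).congr fun k => ?_
          simp only [Function.comp]
          congr 1
          push_cast; ring
        have h3 := (h2.mul (h1.const_mul ((q : ℂ) ^ ((j : ℤ) * (j - 1) / 2) * (-1) ^ j))).mul_const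
          (eulerCoeff q j * (q : ℂ) ^ j)
        simpa [F, hj] using h3
    · rcases lt_or_ge j 0 with h | h
      · simp [F, eulerCoeff_of_neg h]
      · simp only [F]
        rw [norm_mul, norm_mul]
        gcongr
        suffices h1 : ‖(q : ℂ) ^ (j * (j - 1) / 2) * (-1) ^ j * ((q : ℂ) ^ k) ^ j‖ ≤ 1 from
          (mul_le_mul (hM _) h1 (norm_nonneg _) hM0).trans_eq (mul_one M)
        lift j to ℕ using h
        obtain ⟨t, ht⟩ := Int.eq_ofNat_of_zero_le (triangle_nonneg j)
        rw [ht]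
        simp only [norm_mul, norm_pow, norm_neg, norm_one, one_pow, mul_one, zpow_natCast,
          Complex.norm_real, Real.norm_eq_abs, abs_of_pos hq0, ← pow_mul]
        exact mul_le_one₀ (pow_le_one₀ hq0.le hq1.le) (by positivity) (pow_le_one₀ hq0.le hq1.le)
  rw [tsum_ite_eq] at hlim
  exact tendsto_nhds_unique (tendsto_const_nhds.congr key) hlim

/-- Jacobi's triple product. The Laurent coefficients of `(x; q)_∞ (q / x; q)_∞` satisfy the
recurrence of those of `θ(-x)`, hence are proportional to them. -/
theorem theta_neg_eq (hq0 : 0 < q) (hq1 : q < 1) {x : ℂ} (hx : x ≠ 0) :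
    theta q (-x) = qPochInf q q * (qPochInf x q * qPochInf (q / x) q) := by
  have hq : (q : ℂ) ≠ 0 := by exact_mod_cast hq0.ne'
  rw [← (hasSum_tripleCoeff hq0 hq1 hx).tsum_eq, theta, ← tsum_mul_left]
  refine tsum_congr fun k => ?_
  rw [eq_triangle_of_recurrence hq (by norm_num) (tripleCoeff_succ hq0 hq1) k,
    tripleCoeff_zero hq0 hq1, neg_eq_neg_one_mul, mul_zpow]
  have := qPochInf_self_ne_zero hq0 hq1
  field_simp

end Euler

/-! ### The modular transformation -/

section Modular

variable {q : ℝ}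

lemma kappa_mul_log (hq0 : 0 < q) (hq1 : q < 1) : kappa q * Real.log q = -(2 * Real.pi) := by
  rw [kappa, div_mul_cancel₀ _ (Real.log_neg hq0 hq1).ne]

lemma kappa_pos (hq0 : 0 < q) (hq1 : q < 1) : 0 < kappa q :=
  div_pos_of_neg_of_neg (by linarith [Real.pi_pos]) (Real.log_neg hq0 hq1)

/-- The base `e^{-2πκ}` dual to `q` under the modular transformation of the theta function. -/
def dualBase (q : ℝ) : ℝ := Real.exp (-(2 * Real.pi * kappa q))

lemma dualBase_pos (q : ℝ) : 0 < dualBase q := Real.exp_pos _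

lemma dualBase_lt_one (hq0 : 0 < q) (hq1 : q < 1) : dualBase q < 1 := by
  have := kappa_pos hq0 hq1
  have := Real.pi_pos
  rw [dualBase, Real.exp_lt_one_iff]
  exact neg_neg_of_pos (by positivity)

/-- Jacobi's imaginary transformation of `θ`, in the variable `log x`. -/
lemma theta_modular (hq0 : 0 < q) (hq1 : q < 1) : ∃ K : ℂ, ∀ y : ℂ,
    theta q (Complex.exp y) = K * Complex.exp (-(y - Real.log q / 2) ^ 2 / (2 * Real.log q)) *
      theta (dualBase q) (Complex.exp (-(kappa q * Complex.I * y) - Real.pi * Complex.I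
        - Real.pi * kappa q)) := by
  have hpi : (Real.pi : ℂ) ≠ 0 := by exact_mod_cast Real.pi_ne_zero
  have hI := Complex.I_ne_zero
  have hlog : (Real.log q : ℂ) ≠ 0 := by exact_mod_cast (Real.log_neg hq0 hq1).ne
  have hk : (kappa q : ℂ) = -(2 * Real.pi) / Real.log q := by
    rw [kappa]; push_cast; rfl
  set τ : ℂ := (Real.log q : ℂ) / (2 * Real.pi * Complex.I) with hτ
  refine ⟨1 / (-Complex.I * τ) ^ (1 / 2 : ℂ), fun y => ?_⟩
  rw [theta_exp_eq hq0, theta_exp_eq (dualBase_pos q), jacobiTheta₂_functional_equation, ← hτ]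
  have h1 : -Real.pi * Complex.I * ((y - Real.log q / 2) / (2 * Real.pi * Complex.I)) ^ 2 / τ =
      -(y - Real.log q / 2) ^ 2 / (2 * Real.log q) := by
    rw [hτ]
    field_simp
  have h2 : (y - Real.log q / 2) / (2 * Real.pi * Complex.I) / τ =
      (-(kappa q * Complex.I * y) - Real.pi * Complex.I - Real.pi * kappa q -
        Real.log (dualBase q) / 2) / (2 * Real.pi * Complex.I) := by
    rw [dualBase, Real.log_exp, hτ]
    push_cast
    rw [hk]
    field_simp
    ring
  have h3 : -1 / τ = Real.log (dualBase q) / (2 * Real.pi * Complex.I) := by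
    rw [dualBase, Real.log_exp, hτ]
    push_cast
    rw [hk]
    field_simp
    simp only [Complex.I_sq]
    ring
  rw [h1, h2, h3]

/-- The quotient `θ(-q^μ / t) / θ(-1 / t)` is, up to a constant and the factor `t^μ`, the quotient
of theta functions of the dual base in the variable `t^{κi}`. -/
lemma theta_ratio_modular (hq0 : 0 < q) (hq1 : q < 1) (mu : ℂ) : ∃ K : ℂ, K ≠ 0 ∧ ∀ w : ℂ,
    theta q (-((q : ℂ) ^ mu * Complex.exp (-w))) *
        theta (dualBase q) (-Complex.exp (kappa q * Complex.I * w)) =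
      K * Complex.exp (mu * w) * theta q (-Complex.exp (-w)) *
        theta (dualBase q) (-(Complex.exp (2 * Real.pi * Complex.I * mu) *
          Complex.exp (kappa q * Complex.I * w))) := by
  obtain ⟨K, h⟩ := theta_modular hq0 hq1
  have hlog : (Real.log q : ℂ) ≠ 0 := by exact_mod_cast (Real.log_neg hq0 hq1).ne
  have hk : (kappa q : ℂ) * Real.log q = -(2 * Real.pi) := by
    exact_mod_cast kappa_mul_log hq0 hq1
  have hneg : ∀ z : ℂ, -Complex.exp z = Complex.exp (z + Real.pi * Complex.I) := fun z => by
    rw [Complex.exp_add, Complex.exp_pi_mul_I, mul_neg_one]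
  have hneg' : ∀ z : ℂ, -Complex.exp z = Complex.exp (z - Real.pi * Complex.I) := fun z => by
    rw [Complex.exp_sub, Complex.exp_pi_mul_I, div_neg, div_one]
  have hqmu : (q : ℂ) ^ mu = Complex.exp (Real.log q * mu) := by
    rw [Complex.cpow_def_of_ne_zero (by exact_mod_cast hq0.ne'), Complex.ofReal_log hq0.le]
  refine ⟨Complex.exp (-(mu * (Real.pi * Complex.I - Real.log q / 2)
    + mu ^ 2 * Real.log q / 2)), Complex.exp_ne_zero _, fun w => ?_⟩
  have h1 := h (Real.log q * mu + -w + Real.pi * Complex.I)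
  have h2 := h (-w + Real.pi * Complex.I)
  have e1 : Complex.exp (-(kappa q * Complex.I * (Real.log q * mu + -w + Real.pi * Complex.I)) -
      Real.pi * Complex.I - Real.pi * kappa q) = -(Complex.exp (2 * Real.pi * Complex.I * mu) *
          Complex.exp (kappa q * Complex.I * w)) := by
    rw [← Complex.exp_add, hneg']
    congr 1
    linear_combination (-Complex.I * mu) * hk - kappa q * Real.pi * Complex.I_sq
  have e2 : Complex.exp (-(kappa q * Complex.I * (-w + Real.pi * Complex.I)) -
      Real.pi * Complex.I - Real.pi * kappa q) = -Complex.exp (kappa q * Complex.I * w) := by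
    rw [hneg']
    congr 1
    linear_combination (- kappa q * Real.pi) * Complex.I_sq
  have e3 : Complex.exp (-(Real.log q * mu + -w + Real.pi * Complex.I - Real.log q / 2) ^ 2 /
      (2 * Real.log q)) = Complex.exp (-(mu * (Real.pi * Complex.I - Real.log q / 2)
    + mu ^ 2 * Real.log q / 2)) * Complex.exp (mu * w) *
      Complex.exp (-(-w + Real.pi * Complex.I - Real.log q / 2) ^ 2 / (2 * Real.log q)) := by
    rw [← Complex.exp_add, ← Complex.exp_add]
    congr 1
    field_simp
    ring
  rw [e1, e3] at h1
  rw [e2] at h2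
  rw [hqmu, ← Complex.exp_add, hneg (Real.log q * mu + -w), hneg (-w), h1, h2]
  ring

end Modular

/-! ### Kronecker's series -/

section Kronecker

variable {r : ℝ} {A : ℂ}

/-- The coefficient `1 / (1 - A r ^ l)` of Kronecker's series. -/
def kroneckerCoeff (r : ℝ) (A : ℂ) (l : ℤ) : ℂ := (1 - A * (r : ℂ) ^ l)⁻¹

/-- Kronecker's series `∑ z ^ l / (1 - A r ^ l)`, convergent in the annulus `r < |z| < 1`. -/
def kroneckerSeries (r : ℝ) (A z : ℂ) : ℂ := ∑' l, kroneckerCoeff r A l * z ^ l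

lemma exists_kroneckerCoeff_bound (hr0 : 0 < r) (hr1 : r < 1) (hA0 : A ≠ 0) :
    ∃ M : ℝ, 0 ≤ M ∧ ∀ n : ℕ, ‖kroneckerCoeff r A n‖ ≤ M ∧ ‖kroneckerCoeff r A (-n)‖ ≤ M * r ^ n := by
  have hr : (r : ℂ) ≠ 0 := by exact_mod_cast hr0.ne'
  have hpow : Tendsto (fun n : ℕ => (r : ℂ) ^ n) atTop (𝓝 0) :=
    tendsto_pow_atTop_nhds_zero_of_norm_lt_one (by simpa [abs_of_pos hr0] using hr1)
  obtain ⟨M, hM⟩ := exists_norm_le_of_tendsto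
    (u := fun n : ℕ => (1 - A * (r : ℂ) ^ n)⁻¹) (a := (1 - A * 0)⁻¹)
    ((tendsto_const_nhds.sub (hpow.const_mul A)).inv₀ (by simp))
  obtain ⟨M', hM'⟩ := exists_norm_le_of_tendsto
    (u := fun n : ℕ => ((r : ℂ) ^ n - A)⁻¹) (a := (0 - A)⁻¹)
    ((hpow.sub tendsto_const_nhds).inv₀ (by simpa using hA0))
  refine ⟨max M M', ((norm_nonneg _).trans (hM 0)).trans (le_max_left _ _), fun n => ⟨?_, ?_⟩⟩
  · simpa [kroneckerCoeff] using (hM n).trans (le_max_left M M')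
  · have h1 : kroneckerCoeff r A (-n) = ((r : ℂ) ^ n - A)⁻¹ * (r : ℂ) ^ n := by
      have := pow_ne_zero n hr
      rw [kroneckerCoeff, zpow_neg, zpow_natCast]
      rw [show (1 : ℂ) - A * ((r : ℂ) ^ n)⁻¹ = ((r : ℂ) ^ n - A) / (r : ℂ) ^ n by field_simp,
        inv_div, div_eq_inv_mul]
    rw [h1, norm_mul, norm_pow, Complex.norm_real, Real.norm_eq_abs, abs_of_pos hr0]
    exact mul_le_mul_of_nonneg_right ((hM' n).trans (le_max_right M M')) (by positivity)

lemma summable_kronecker (hr0 : 0 < r) (hr1 : r < 1) (hA0 : A ≠ 0) {z : ℂ} (hz : r < ‖z‖)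
    (hz1 : ‖z‖ < 1) : Summable fun l => kroneckerCoeff r A l * z ^ l := by
  obtain ⟨M, hM0, hM⟩ := exists_kroneckerCoeff_bound hr0 hr1 hA0
  have hz0 : 0 < ‖z‖ := hr0.trans hz
  refine Summable.of_nat_of_neg ?_ ?_
  · refine Summable.of_norm_bounded
      ((summable_geometric_of_lt_one hz0.le hz1).mul_left M) fun n => ?_
    rw [norm_mul, norm_zpow, zpow_natCast]
    exact mul_le_mul_of_nonneg_right (hM n).1 (by positivity)
  · refine Summable.of_norm_bounded ((summable_geometric_of_lt_one (r := r / ‖z‖) (by positivity)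
      ((div_lt_one hz0).2 hz)).mul_left M) fun n => ?_
    rw [norm_mul, norm_zpow, zpow_neg, zpow_natCast, div_pow, ← mul_div_assoc, div_eq_mul_inv]
    exact mul_le_mul_of_nonneg_right (hM n).2 (by positivity)

/-- Kronecker's identity: the product of Kronecker's series with `θ(-z)` is proportional to
`θ(-A z)`. The Laurent coefficients of the product satisfy a first order recurrence,
because `(1 - A r ^ l) / (1 - A r ^ l) = 1` and `θ(-1) = 0`. -/
theorem exists_kroneckerSeries_mul_theta (hr0 : 0 < r) (hr1 : r < 1) (hA0 : A ≠ 0)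
    (hA : ∀ l : ℤ, A * (r : ℂ) ^ l ≠ 1) :
    ∃ K : ℂ, ∀ z : ℂ, r < ‖z‖ → ‖z‖ < 1 →
      kroneckerSeries r A z * theta r (-z) = K * theta r (-(A * z)) := by
  have hr : (r : ℂ) ≠ 0 := by exact_mod_cast hr0.ne'
  set τ : ℤ → ℂ := fun n => (r : ℂ) ^ (n * (n - 1) / 2) * (-1) ^ n with hτ
  have hτs : Summable τ := summable_theta hr0 hr1 (by norm_num)
  have hτsum : ∑' n, τ n = 0 := theta_neg_one r
  have hτsucc : ∀ n, τ (n + 1) = -(r : ℂ) ^ n * τ n := fun n => by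
    simp only [hτ]
    rw [triangle_succ, zpow_add₀ hr, zpow_add_one₀ (a := (-1 : ℂ)) (by norm_num)]
    ring
  obtain ⟨B, hB⟩ : ∃ B : ℝ, ∀ l, ‖kroneckerCoeff r A l‖ ≤ B := by
    obtain ⟨M, hM0, hM⟩ := exists_kroneckerCoeff_bound hr0 hr1 hA0
    refine ⟨M, fun l => ?_⟩
    obtain ⟨n, rfl | rfl⟩ := l.eq_nat_or_neg
    · exact (hM n).1
    · exact (hM n).2.trans (mul_le_of_le_one_right hM0 (pow_le_one₀ hr0.le hr1.le))
  have hshift : ∀ m : ℤ, Summable fun l => τ (m - l) := fun m => by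
    simpa only [Function.comp_def, Equiv.subLeft_apply] using
      hτs.comp_injective (Equiv.subLeft m).injective
  have hs : ∀ m : ℤ, Summable fun l => kroneckerCoeff r A l * τ (m - l) := fun m => by
    refine Summable.of_norm_bounded ((hshift m).norm.mul_left B) fun l => ?_
    rw [norm_mul]
    exact mul_le_mul_of_nonneg_right (hB l) (norm_nonneg _)
  set X : ℤ → ℂ := fun m => ∑' l, kroneckerCoeff r A l * τ (m - l) with hX
  have hrec : ∀ m, X (m + 1) = -A * (r : ℂ) ^ m * X m := by
    intro m
    have h1 : ∑' l, τ (m + 1 - l) = 0 := by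
      rw [← hτsum, ← (Equiv.subLeft (m + 1)).tsum_eq τ]
      rfl
    have h2 : ∀ l, kroneckerCoeff r A l * τ (m + 1 - l) =
        τ (m + 1 - l) + -A * (r : ℂ) ^ m * (kroneckerCoeff r A l * τ (m - l)) := by
      intro l
      have h3 : kroneckerCoeff r A l * (1 - A * (r : ℂ) ^ l) = 1 :=
        inv_mul_cancel₀ (sub_ne_zero.2 (hA l).symm)
      have h4 := hτsucc (m - l)
      rw [show m - l + 1 = m + 1 - l by ring] at h4
      have h5 : (r : ℂ) ^ m = (r : ℂ) ^ l * (r : ℂ) ^ (m - l) := by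
        rw [← zpow_add₀ hr]; congr 1; ring
      linear_combination τ (m + 1 - l) * h3 - A * (r : ℂ) ^ l * kroneckerCoeff r A l * (-1) * h4
        - A * kroneckerCoeff r A l * τ (m - l) * (-1) * h5
    simp only [hX]
    rw [tsum_congr h2, (hshift (m + 1)).tsum_add ((hs m).mul_left _), h1, tsum_mul_left, zero_add]
  refine ⟨X 0, fun z hz hz1 => ?_⟩
  have hz0 : z ≠ 0 := norm_pos_iff.1 (hr0.trans hz)
  have hconv := hasSum_int_convolution (summable_kronecker hr0 hr1 hA0 hz hz1)
    (summable_theta hr0 hr1 (neg_ne_zero.2 hz0))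
  have hneg : ∀ n : ℤ, (-z) ^ n = (-1) ^ n * z ^ n := fun n => by
    rw [neg_eq_neg_one_mul, mul_zpow]
  rw [kroneckerSeries, theta, ← hconv.tsum_eq, theta, ← tsum_mul_left]
  refine tsum_congr fun k => ?_
  have h1 := eq_triangle_of_recurrence hr (neg_ne_zero.2 hA0) hrec k
  have h2 : -(A * z) = -A * z := by ring
  rw [h2, mul_zpow, ← mul_assoc ((r : ℂ) ^ _), ← mul_assoc, ← h1, hX, ← tsum_mul_right]
  refine tsum_congr fun l => ?_
  have h3 : z ^ k = z ^ l * z ^ (k - l) := by rw [← zpow_add₀ hz0]; congr 1; ring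
  rw [hneg, h3]
  ring

/-- Up to a bounded function near `z = 1`, Kronecker's series is the sum of `z ^ l`
over `l ≥ 0`. -/
lemma exists_kroneckerSeries_bound (hr0 : 0 < r) (hr1 : r < 1) (hA0 : A ≠ 0)
    (hA : ∀ l : ℤ, A * (r : ℂ) ^ l ≠ 1) : ∃ B s : ℝ, s < 1 ∧ ∀ z : ℝ, s < z → z < 1 →
      ‖(1 - (z : ℂ)) * kroneckerSeries r A z - 1‖ ≤ (1 - z) * B := by
  obtain ⟨M, hM0, hM⟩ := exists_kroneckerCoeff_bound hr0 hr1 hA0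
  set s := Real.sqrt r with hs
  have hs0 : 0 < s := Real.sqrt_pos.2 hr0
  have hss : s * s = r := Real.mul_self_sqrt hr0.le
  have hs1 : s < 1 := by nlinarith
  have hrs : r < s := by nlinarith
  have b1 := (summable_geometric_of_lt_one hr0.le hr1).mul_left (‖A‖ * M)
  have b2 := (summable_geometric_of_lt_one hs0.le hs1).mul_left M
  refine ⟨∑' n : ℕ, ‖A‖ * M * r ^ n + ∑' n : ℕ, M * s ^ n, s, hs1, ?_⟩
  intro z hz hz1
  have hz0 : 0 < z := hs0.trans hz
  have hzn : ‖(z : ℂ)‖ = z := by simp [abs_of_pos hz0]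
  have hsum := summable_kronecker hr0 hr1 hA0 (z := (z : ℂ)) (by rw [hzn]; exact hrs.trans hz)
    (by rw [hzn]; exact hz1)
  have e1 : ∀ n : ℕ, kroneckerCoeff r A n * (z : ℂ) ^ (n : ℤ) =
      (z : ℂ) ^ n + A * (r : ℂ) ^ n * kroneckerCoeff r A n * (z : ℂ) ^ n := by
    intro n
    have h3 : kroneckerCoeff r A n * (1 - A * (r : ℂ) ^ (n : ℤ)) = 1 :=
      inv_mul_cancel₀ (sub_ne_zero.2 (hA n).symm)
    rw [zpow_natCast] at h3 ⊢
    linear_combination (z : ℂ) ^ n * h3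
  have n1 : ∀ n : ℕ, ‖A * (r : ℂ) ^ n * kroneckerCoeff r A n * (z : ℂ) ^ n‖ ≤
      ‖A‖ * M * r ^ n := by
    intro n
    rw [norm_mul, norm_mul, norm_mul, norm_pow, norm_pow, hzn, Complex.norm_real,
      Real.norm_eq_abs, abs_of_pos hr0]
    calc ‖A‖ * r ^ n * ‖kroneckerCoeff r A n‖ * z ^ n ≤ ‖A‖ * r ^ n * M * 1 := by
          gcongr
          · exact (hM n).1
          · exact pow_le_one₀ hz0.le hz1.le
      _ = ‖A‖ * M * r ^ n := by ring
  have n2 : ∀ n : ℕ, ‖kroneckerCoeff r A (-(n + 1)) * (z : ℂ) ^ (-(n + 1) : ℤ)‖ ≤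
      M * s ^ n := by
    intro n
    have h := (hM (n + 1)).2
    push_cast at h
    have h5 : ((n : ℤ) + 1) = ((n + 1 : ℕ) : ℤ) := by push_cast; rfl
    rw [norm_mul, norm_zpow, hzn]
    rw [h5] at h ⊢
    rw [zpow_neg, zpow_natCast]
    have h6 : r ^ (n + 1) * (z ^ (n + 1))⁻¹ ≤ s ^ n := by
      rw [← div_eq_mul_inv, ← div_pow]
      have h7 : r / z ≤ s := by
        rw [div_le_iff₀ hz0]; nlinarith
      calc (r / z) ^ (n + 1) ≤ s ^ (n + 1) := by gcongr
        _ ≤ s ^ n := pow_le_pow_of_le_one hs0.le hs1.le (Nat.le_succ n)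
    have hz2 : 0 ≤ (z ^ (n + 1))⁻¹ := by positivity
    nlinarith [mul_le_mul_of_nonneg_right h hz2, mul_le_mul_of_nonneg_left h6 hM0]
  have hgeo : HasSum (fun n : ℕ => (z : ℂ) ^ n) (1 - (z : ℂ))⁻¹ :=
    hasSum_geometric_of_norm_lt_one (by rw [hzn]; exact hz1)
  have sR1 : Summable fun n : ℕ => A * (r : ℂ) ^ n * kroneckerCoeff r A n * (z : ℂ) ^ n :=
    Summable.of_norm_bounded b1 n1
  have sR2 : Summable fun n : ℕ => kroneckerCoeff r A (-(n + 1)) * (z : ℂ) ^ (-(n + 1) : ℤ) :=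
    Summable.of_norm_bounded b2 n2
  have hS : kroneckerSeries r A z = (1 - (z : ℂ))⁻¹ +
      ∑' n : ℕ, A * (r : ℂ) ^ n * kroneckerCoeff r A n * (z : ℂ) ^ n +
      ∑' n : ℕ, kroneckerCoeff r A (-(n + 1)) * (z : ℂ) ^ (-(n + 1) : ℤ) := by
    have hp := hgeo.add sR1.hasSum
    rw [← funext e1] at hp
    exact (HasSum.of_nat_of_neg_add_one (f := fun l : ℤ => kroneckerCoeff r A l * (z : ℂ) ^ l)
      hp sR2.hasSum).tsum_eq
  have hz' : (1 - (z : ℂ)) ≠ 0 := by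
    rw [sub_ne_zero]; exact_mod_cast hz1.ne'
  have hn : ‖(1 - (z : ℂ))‖ = 1 - z := by
    rw [show (1 : ℂ) - z = ((1 - z : ℝ) : ℂ) by push_cast; rfl, Complex.norm_real,
      Real.norm_eq_abs, abs_of_pos (by linarith)]
  have heq : (1 - (z : ℂ)) * kroneckerSeries r A z - 1 = (1 - (z : ℂ)) *
      (∑' n : ℕ, A * (r : ℂ) ^ n * kroneckerCoeff r A n * (z : ℂ) ^ n +
      ∑' n : ℕ, kroneckerCoeff r A (-(n + 1)) * (z : ℂ) ^ (-(n + 1) : ℤ)) := by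
    rw [hS]; field_simp; ring
  rw [heq, norm_mul, hn]
  refine mul_le_mul_of_nonneg_left ?_ (by linarith)
  exact (norm_add_le _ _).trans (add_le_add (tsum_of_norm_bounded b1.hasSum n1)
    (tsum_of_norm_bounded b2.hasSum n2))

/-- Kronecker's series has a simple pole at `z = 1`, with `(1 - z)⁻¹` as its singular part. -/
lemma tendsto_one_sub_mul_kroneckerSeries (hr0 : 0 < r) (hr1 : r < 1) (hA0 : A ≠ 0)
    (hA : ∀ l : ℤ, A * (r : ℂ) ^ l ≠ 1) :
    Tendsto (fun z : ℝ => (1 - (z : ℂ)) * kroneckerSeries r A z) (𝓝[<] 1) (𝓝 1) := by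
  obtain ⟨B, s, hs1, hbound⟩ := exists_kroneckerSeries_bound hr0 hr1 hA0 hA
  rw [tendsto_iff_norm_sub_tendsto_zero]
  have hlim : Tendsto (fun z : ℝ => (1 - z) * B) (𝓝[<] 1) (𝓝 0) := by
    have h : Tendsto (fun z : ℝ => (1 - z) * B) (𝓝 1) (𝓝 ((1 - 1) * B)) :=
      (by fun_prop : Continuous fun z : ℝ => (1 - z) * B).tendsto 1
    rw [sub_self, zero_mul] at h
    exact h.mono_left nhdsWithin_le_nhds
  refine squeeze_zero' (Eventually.of_forall fun _ => norm_nonneg _) ?_ hlim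
  filter_upwards [Ioo_mem_nhdsLT hs1] with z hz using hbound z hz.1 hz.2

end Kronecker

/-! ### The expansion of the kernel -/

section Kernel

variable {q : ℝ}

/-- A Laurent series is continuous along the circle through a point of absolute convergence. -/
lemma tendsto_laurent {c : ℤ → ℂ} {x : ℂ} (hx : x ≠ 0) (hs : Summable fun n : ℤ => c n * x ^ n)
    {ι : Type*} {F : Filter ι} {u : ι → ℂ} (hu : ∀ i, ‖u i‖ = 1) (hlim : Tendsto u F (𝓝 1)) :
    Tendsto (fun i => ∑' n, c n * (x * u i) ^ n) F (𝓝 (∑' n, c n * x ^ n)) := by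
  refine tendsto_tsum_of_dominated_convergence hs.norm (fun n => ?_)
    (Eventually.of_forall fun i n => ?_)
  · have h := (hlim.const_mul x).zpow₀ n (Or.inl (by simpa using hx))
    rw [mul_one] at h
    exact h.const_mul (c n)
  · rw [norm_mul, norm_mul, norm_zpow, norm_mul, hu, mul_one, norm_zpow]

lemma tendsto_qPochInf_mul (hq0 : 0 < q) (hq1 : q < 1) {x : ℂ} (hx : x ≠ 0) {ι : Type*}
    {F : Filter ι} {u : ι → ℂ} (hu : ∀ i, ‖u i‖ = 1) (hlim : Tendsto u F (𝓝 1)) :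
    Tendsto (fun i => qPochInf (x * u i) q) F (𝓝 (qPochInf x q)) := by
  have h := tendsto_laurent hx (summable_eulerCoeff hq0 hq1 hx) hu hlim
  rw [← qPochInf_eq_tsum hq0 hq1 hx] at h
  refine h.congr fun i => (qPochInf_eq_tsum hq0 hq1 (mul_ne_zero hx fun h0 => ?_)).symm
  simpa [h0] using hu i

lemma tendsto_theta_mul (hq0 : 0 < q) (hq1 : q < 1) {x : ℂ} (hx : x ≠ 0) {ι : Type*}
    {F : Filter ι} {u : ι → ℂ} (hu : ∀ i, ‖u i‖ = 1) (hlim : Tendsto u F (𝓝 1)) :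
    Tendsto (fun i => theta q (-(x * u i))) F (𝓝 (theta q (-x))) := by
  simp only [← neg_mul]
  exact tendsto_laurent (neg_ne_zero.2 hx) (summable_theta hq0 hq1 (neg_ne_zero.2 hx)) hu hlim

lemma tendsto_one_sub_exp_div (c : ℂ) :
    Tendsto (fun δ : ℝ => (1 - Complex.exp (c * δ)) / δ) (𝓝[>] 0) (𝓝 (-c)) := by
  have h1 : HasDerivAt (fun δ : ℝ => Complex.exp (c * δ)) c 0 := by
    have h : HasDerivAt (fun z : ℂ => Complex.exp (c * z)) c ((0 : ℝ) : ℂ) := by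
      have := ((hasDerivAt_id ((0 : ℝ) : ℂ)).const_mul c).cexp
      simpa using this
    exact h.comp_ofReal
  have h2 := h1.tendsto_slope_zero_right.neg
  refine h2.congr fun δ => ?_
  simp only [zero_add, Complex.ofReal_zero, mul_zero, Complex.exp_zero, Complex.real_smul,
    Complex.ofReal_inv]
  rw [div_eq_inv_mul]; ring

lemma exp_mul_dualBase_zpow (mu : ℂ) (l : ℤ) :
    Complex.exp (2 * Real.pi * Complex.I * mu) * (dualBase q : ℂ) ^ l =
      Complex.exp (2 * (Real.pi : ℂ) * Complex.I * (mu + (kappa q : ℂ) * Complex.I * (l : ℂ))) := by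
  rw [dualBase, Complex.ofReal_exp, ← Complex.exp_int_mul, ← Complex.exp_add]
  congr 1
  push_cast
  linear_combination (-2 * Real.pi * kappa q * l) * Complex.I_sq

/-- The condition `q^μ ∉ q^ℤ` says that the denominators of Kronecker's series do not vanish. -/
lemma exp_mul_dualBase_zpow_ne_one (hq0 : 0 < q) (hq1 : q < 1) {mu : ℂ}
    (hmu : ∀ k : ℤ, (q : ℂ) ^ mu ≠ (q : ℂ) ^ k) (l : ℤ) :
    Complex.exp (2 * Real.pi * Complex.I * mu) * (dualBase q : ℂ) ^ l ≠ 1 := by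
  rw [exp_mul_dualBase_zpow]
  intro h
  obtain ⟨k, hk⟩ := Complex.exp_eq_one_iff.1 h
  have hpi : (Real.pi : ℂ) ≠ 0 := by exact_mod_cast Real.pi_ne_zero
  have hmu' : mu = k - (kappa q : ℂ) * Complex.I * (l : ℂ) := by
    have hI := Complex.I_ne_zero
    have h2 : (2 * (Real.pi : ℂ) * Complex.I) ≠ 0 := by simp [hpi]
    apply mul_left_cancel₀ h2
    linear_combination hk
  have hq : (q : ℂ) ≠ 0 := by exact_mod_cast hq0.ne'
  have hkl : (kappa q : ℂ) * Real.log q = -(2 * Real.pi) := by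
    exact_mod_cast kappa_mul_log hq0 hq1
  apply hmu k
  rw [Complex.cpow_def_of_ne_zero hq, ← Complex.ofReal_log hq0.le, hmu']
  have h3 : (Real.log q : ℂ) * (k - (kappa q : ℂ) * Complex.I * (l : ℂ)) =
      k * Real.log q + l * (2 * Real.pi * Complex.I) := by
    linear_combination (-Complex.I * l) * hkl
  rw [h3, Complex.exp_add, Complex.exp_int_mul_two_pi_mul_I, mul_one, Complex.exp_int_mul,
    ← Complex.ofReal_exp, Real.exp_log hq0]

lemma norm_exp_kappa (w : ℂ) :
    ‖Complex.exp (kappa q * Complex.I * w)‖ = Real.exp (-(kappa q * w.im)) := by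
  rw [Complex.norm_exp]
  simp

lemma dualBase_lt_norm (hq0 : 0 < q) (hq1 : q < 1) {w : ℂ} (hw : w.im < 2 * Real.pi) :
    dualBase q < ‖Complex.exp (kappa q * Complex.I * w)‖ := by
  rw [norm_exp_kappa, dualBase, Real.exp_lt_exp]
  nlinarith [kappa_pos hq0 hq1]

lemma norm_exp_kappa_lt_one (hq0 : 0 < q) (hq1 : q < 1) {w : ℂ} (hw : 0 < w.im) :
    ‖Complex.exp (kappa q * Complex.I * w)‖ < 1 := by
  rw [norm_exp_kappa, Real.exp_lt_one_iff]
  nlinarith [kappa_pos hq0 hq1]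

lemma theta_neg_ne_zero (hq0 : 0 < q) (hq1 : q < 1) {z : ℂ} (hz : q < ‖z‖) (hz1 : ‖z‖ < 1) :
    theta q (-z) ≠ 0 := by
  have hz0 : 0 < ‖z‖ := hq0.trans hz
  have key : ∀ y : ℂ, ‖y‖ < 1 → qPochInf y q ≠ 0 := fun y hy => by
    refine qPochInf_ne_zero hq0 hq1 fun j hj => ?_
    have h1 : ‖y * (q : ℂ) ^ j‖ < 1 := by
      rw [norm_mul, norm_pow, Complex.norm_real, Real.norm_eq_abs, abs_of_pos hq0]
      exact (mul_le_of_le_one_right (norm_nonneg y) (pow_le_one₀ hq0.le hq1.le)).trans_lt hy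
    rw [hj, norm_one] at h1
    exact lt_irrefl _ h1
  rw [theta_neg_eq hq0 hq1 (norm_pos_iff.1 hz0)]
  refine mul_ne_zero (qPochInf_self_ne_zero hq0 hq1) (mul_ne_zero (key _ hz1) (key _ ?_))
  rw [norm_div, Complex.norm_real, Real.norm_eq_abs, abs_of_pos hq0]
  exact (div_lt_one hz0).2 hz

/-- On the strip `0 < Im w < 2π` the exponential `e ^ (-w)` is never a power `q ^ (-j)`. -/
lemma qPochInf_exp_ne_zero (hq0 : 0 < q) (hq1 : q < 1) {w : ℂ} (hw0 : 0 < w.im)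
    (hw1 : w.im < 2 * Real.pi) : qPochInf (Complex.exp (-w)) q ≠ 0 := by
  refine qPochInf_ne_zero hq0 hq1 fun j h => ?_
  have h1 : (q : ℂ) ^ j = Complex.exp (j * Real.log q) := by
    rw [Complex.exp_nat_mul, ← Complex.ofReal_exp, Real.exp_log hq0]
  rw [h1, ← Complex.exp_add] at h
  obtain ⟨k, hk⟩ := Complex.exp_eq_one_iff.1 h
  have him := congrArg Complex.im hk
  simp at him
  have hk0 : (0 : ℝ) < -k := by nlinarith [Real.pi_pos]
  have hk1 : (-k : ℝ) < 1 := by nlinarith [Real.pi_pos]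
  norm_cast at hk0 hk1
  omega

lemma theta_neg_exp_neg (hq0 : 0 < q) (hq1 : q < 1) (w : ℂ) :
    theta q (-Complex.exp (-w)) = qPochInf q q * ((1 - Complex.exp (-w)) *
      qPochInf (q * Complex.exp (-w)) q * qPochInf (q * Complex.exp w) q) := by
  rw [theta_neg_eq hq0 hq1 (Complex.exp_ne_zero _), ← qPochInf_eq_mul hq0 hq1, Complex.exp_neg,
    div_inv_eq_mul]

/-- The expansion of the kernel of the Laplace integral in the variable `w = log t`: it is `t^μ`
times a Laurent series in `t^{κi}` times an entire function of `t`. The theta quotient is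
proportional to Kronecker's series by the modular transformation; the constant is found by
comparing the simple poles at `t = 1`, along `w = δ i` with `δ → 0+`. -/
theorem theta_div_qPochInf (hq0 : 0 < q) (hq1 : q < 1) {mu : ℂ}
    (hmu : ∀ k : ℤ, (q : ℂ) ^ mu ≠ (q : ℂ) ^ k) {w : ℂ} (hw0 : 0 < w.im)
    (hw1 : w.im < 2 * Real.pi) :
    theta q (-((q : ℂ) ^ mu * Complex.exp (-w))) / qPochInf (Complex.exp (-w)) q =
      connectionConst q mu * (Complex.exp (mu * w) *
        kroneckerSeries (dualBase q) (Complex.exp (2 * Real.pi * Complex.I * mu))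
          (Complex.exp (kappa q * Complex.I * w)) * qPochInf (q * Complex.exp w) q) := by
  have hq : (q : ℂ) ≠ 0 := by exact_mod_cast hq0.ne'
  have hα : (q : ℂ) ^ mu ≠ 0 := by simp [hq]
  have hQ := qPochInf_self_ne_zero hq0 hq1
  have hr0 := dualBase_pos q
  have hr1 := dualBase_lt_one hq0 hq1
  have hA0 := Complex.exp_ne_zero (2 * Real.pi * Complex.I * mu)
  have hA := exp_mul_dualBase_zpow_ne_one hq0 hq1 hmu
  obtain ⟨K, hK0, hK⟩ := theta_ratio_modular hq0 hq1 mu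
  obtain ⟨X, hX⟩ := exists_kroneckerSeries_mul_theta hr0 hr1 hA0 hA
  set S := kroneckerSeries (dualBase q) (Complex.exp (2 * Real.pi * Complex.I * mu)) with hS
  have prop : ∀ w : ℂ, 0 < w.im → w.im < 2 * Real.pi →
      X * theta q (-((q : ℂ) ^ mu * Complex.exp (-w))) = K * Complex.exp (mu * w) *
        theta q (-Complex.exp (-w)) * S (Complex.exp (kappa q * Complex.I * w)) := by
    intro w h0 h1
    have hz := dualBase_lt_norm hq0 hq1 h1
    have hz1 := norm_exp_kappa_lt_one hq0 hq1 h0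
    apply mul_right_cancel₀ (theta_neg_ne_zero hr0 hr1 hz hz1)
    linear_combination X * hK w - K * Complex.exp (mu * w) * theta q (-Complex.exp (-w)) *
      hX _ hz hz1
  -- the limit `w → 0` along the imaginary axis, after division by `1 - e ^ (-w)`
  have hlim : X * theta q (-(q : ℂ) ^ mu) * (kappa q / Complex.I) =
      K * (qPochInf q q * (qPochInf q q * qPochInf q q)) := by
    have hu : ∀ c : ℝ, Tendsto (fun δ : ℝ => Complex.exp (c * (δ * Complex.I))) (𝓝[>] 0) (𝓝 1) := by
      intro c
      have h : Continuous fun δ : ℝ => Complex.exp (c * (δ * Complex.I)) := by fun_prop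
      have h2 := h.tendsto 0
      simp only [Complex.ofReal_zero, zero_mul, mul_zero, Complex.exp_zero] at h2
      exact h2.mono_left nhdsWithin_le_nhds
    have hn : ∀ (c δ : ℝ), ‖Complex.exp (c * (δ * Complex.I))‖ = 1 := fun c δ => by
      rw [← mul_assoc, ← Complex.ofReal_mul, Complex.norm_exp_ofReal_mul_I]
    have l1 := tendsto_theta_mul hq0 hq1 hα (hn (-1)) (hu (-1))
    have l2 := tendsto_qPochInf_mul hq0 hq1 hq (hn (-1)) (hu (-1))
    have l3 := tendsto_qPochInf_mul hq0 hq1 hq (hn 1) (hu 1)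
    have l4 : Tendsto (fun δ : ℝ => Complex.exp (mu * (δ * Complex.I))) (𝓝[>] 0) (𝓝 1) := by
      have h : Continuous fun δ : ℝ => Complex.exp (mu * (δ * Complex.I)) := by fun_prop
      have h2 := h.tendsto 0
      simp only [Complex.ofReal_zero, zero_mul, mul_zero, Complex.exp_zero] at h2
      exact h2.mono_left nhdsWithin_le_nhds
    have l5 : Tendsto (fun δ : ℝ => (1 - (Real.exp (-(kappa q * δ)) : ℂ)) *
        S (Real.exp (-(kappa q * δ)) : ℝ)) (𝓝[>] 0) (𝓝 1) := by
      refine (tendsto_one_sub_mul_kroneckerSeries hr0 hr1 hA0 hA).comp ?_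
      refine tendsto_nhdsWithin_iff.2 ⟨?_, ?_⟩
      · have h : Continuous fun δ : ℝ => Real.exp (-(kappa q * δ)) := by fun_prop
        have h2 := h.tendsto 0
        simp only [mul_zero, neg_zero, Real.exp_zero] at h2
        exact h2.mono_left nhdsWithin_le_nhds
      · filter_upwards [self_mem_nhdsWithin] with δ hδ
        have := mul_pos (kappa_pos hq0 hq1) hδ
        simpa using this
    have l6 : Tendsto (fun δ : ℝ => (1 - Complex.exp (-kappa q * δ)) / δ /
        ((1 - Complex.exp (-Complex.I * δ)) / δ)) (𝓝[>] 0) (𝓝 (-(-kappa q) / -(-Complex.I))) :=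
      (tendsto_one_sub_exp_div _).div (tendsto_one_sub_exp_div _) (by simp)
    rw [neg_neg, neg_neg] at l6
    have L := (l1.const_mul X).mul l6
    have R := ((l4.mul ((l2.mul l3).const_mul (qPochInf q q))).mul l5).const_mul K
    rw [one_mul, mul_one] at R
    refine tendsto_nhds_unique L (R.congr' ?_)
    filter_upwards [Ioo_mem_nhdsGT (show (0 : ℝ) < 2 * Real.pi by positivity)] with δ hδ
    have hδ0 : (δ : ℂ) ≠ 0 := by exact_mod_cast hδ.1.ne'
    have hp := prop (δ * Complex.I) (by simpa using hδ.1) (by simpa using hδ.2)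
    rw [theta_neg_exp_neg hq0 hq1] at hp
    have e1 : Complex.exp (kappa q * Complex.I * (δ * Complex.I)) =
        (Real.exp (-(kappa q * δ)) : ℝ) := by
      rw [Complex.ofReal_exp]; congr 1; push_cast
      linear_combination (kappa q * δ : ℂ) * Complex.I_sq
    have e2 : Complex.exp (-kappa q * δ) = (Real.exp (-(kappa q * δ)) : ℝ) := by
      rw [Complex.ofReal_exp]; congr 1; push_cast; ring
    have e3 : Complex.exp (((-1 : ℝ) : ℂ) * (δ * Complex.I)) = Complex.exp (-(δ * Complex.I)) := by
      congr 1; push_cast; ring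
    have e4 : Complex.exp (((1 : ℝ) : ℂ) * (δ * Complex.I)) = Complex.exp (δ * Complex.I) := by
      congr 1; push_cast; ring
    have e5 : Complex.exp (-Complex.I * δ) = Complex.exp (-(δ * Complex.I)) := by
      congr 1; ring
    have hne : 1 - Complex.exp (-(δ * Complex.I)) ≠ 0 := by
      have h := qPochInf_exp_ne_zero hq0 hq1 (w := δ * Complex.I) (by simpa using hδ.1)
        (by simpa using hδ.2)
      rw [qPochInf_eq_mul hq0 hq1] at h
      exact left_ne_zero_of_mul h
    rw [e1] at hp
    rw [e2, e3, e4, e5, div_div_div_cancel_right₀ hδ0, ← mul_div_assoc, eq_div_iff hne]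
    linear_combination (-(1 - (Real.exp (-(kappa q * δ)) : ℂ))) * hp
  have hX0 : X ≠ 0 := by
    rintro rfl
    rw [zero_mul, zero_mul] at hlim
    exact mul_ne_zero hK0 (mul_ne_zero hQ (mul_ne_zero hQ hQ)) hlim.symm
  have hP := qPochInf_exp_ne_zero hq0 hq1 hw0 hw1
  have hq1mu : (q : ℂ) ^ (1 - mu) = q / (q : ℂ) ^ mu := by
    rw [Complex.cpow_sub _ _ hq, Complex.cpow_one]
  have hp := prop w hw0 hw1
  rw [theta_neg_exp_neg hq0 hq1, ← qPochInf_eq_mul hq0 hq1] at hp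
  rw [theta_neg_eq hq0 hq1 hα] at hlim
  rw [div_eq_iff hP, connectionConst, hq1mu]
  have hI := Complex.I_ne_zero
  have hC : X * (kappa q * (qPochInf ((q : ℂ) ^ mu) q * qPochInf (q / (q : ℂ) ^ mu) q) /
      (Complex.I * qPochInf q q)) = K * qPochInf q q := by
    have h2 : (kappa q : ℂ) * (qPochInf ((q : ℂ) ^ mu) q * qPochInf (q / (q : ℂ) ^ mu) q) /
        (Complex.I * qPochInf q q) * (qPochInf q q * qPochInf q q) = qPochInf q q *
        (qPochInf ((q : ℂ) ^ mu) q * qPochInf (q / (q : ℂ) ^ mu) q) * (kappa q / Complex.I) := by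
      field_simp
    apply mul_right_cancel₀ (mul_ne_zero hQ hQ)
    linear_combination X * h2 + hlim
  apply mul_left_cancel₀ hX0
  rw [hp]
  linear_combination (-(Complex.exp (mu * w) * S (Complex.exp (kappa q * Complex.I * w)) *
    qPochInf (q * Complex.exp w) q * qPochInf (Complex.exp (-w)) q)) * hC

end Kernel

/-! ### Integration term by term -/

/-- A series of integrable functions with summable `L¹` norms has an integrable sum, and can be
integrated term by term. -/
lemma integrable_and_hasSum_integral {α ι : Type*} [MeasurableSpace α] {m : Measure α}
    [Countable ι] {F : ι → α → ℂ} {f : α → ℂ} (hF : ∀ i, Integrable (F i) m)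
    (hsum : Summable fun i => ∫ a, ‖F i a‖ ∂m) (hf : ∀ᵐ a ∂m, HasSum (fun i => F i a) (f a)) :
    Integrable f m ∧ HasSum (fun i => ∫ a, F i a ∂m) (∫ a, f a ∂m) := by
  have hmeas : AEStronglyMeasurable f m :=
    aestronglyMeasurable_of_tendsto_ae (u := (atTop : Filter (Finset ι)))
      (f := fun s a => ∑ i ∈ s, F i a)
      (fun s => Finset.aestronglyMeasurable_fun_sum s fun i _ => (hF i).1) hf
  have hfin : ∫⁻ a, ‖f a‖ₑ ∂m < ⊤ := by
    calc ∫⁻ a, ‖f a‖ₑ ∂m ≤ ∫⁻ a, ∑' i, ‖F i a‖ₑ ∂m := by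
          refine lintegral_mono_ae ?_
          filter_upwards [hf] with a ha
          rw [← ha.tsum_eq]
          exact enorm_tsum_le_tsum_enorm
      _ = ∑' i, ∫⁻ a, ‖F i a‖ₑ ∂m := lintegral_tsum fun i => (hF i).1.enorm
      _ = ∑' i, ENNReal.ofReal (∫ a, ‖F i a‖ ∂m) :=
          tsum_congr fun i => (ofReal_integral_norm_eq_lintegral_enorm (hF i)).symm
      _ < ⊤ := hsum.tsum_ofReal_lt_top
  refine ⟨⟨hmeas, hfin⟩, ?_⟩
  have h := hasSum_integral_of_summable_integral_norm hF hsum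
  rwa [integral_congr_ae (g := f) (by filter_upwards [hf] with a ha using ha.tsum_eq)] at h

/-! ### Laplace and Gamma integrals along half-lines -/

/-- A Laplace integral that converges absolutely in the right half-plane is holomorphic there. -/
lemma differentiableAt_laplace {f : ℝ → ℂ} (hf : ∀ Y : ℂ, 0 < Y.re →
    IntegrableOn (fun s : ℝ => f s * Complex.exp (-(Y * s))) (Set.Ioi 0)) {Y : ℂ} (hY : 0 < Y.re) :
    DifferentiableAt ℂ (fun Y : ℂ => ∫ s in Set.Ioi (0 : ℝ), f s * Complex.exp (-(Y * s))) Y := by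
  set ε := Y.re / 4 with hε
  have hε0 : 0 < ε := by positivity
  have hU : {Z : ℂ | 2 * ε < Z.re} ∈ 𝓝 Y :=
    (isOpen_lt continuous_const Complex.continuous_re).mem_nhds
      (show 2 * ε < Y.re by rw [hε]; linarith)
  have hb : IntegrableOn (fun s : ℝ => ε⁻¹ * ‖f s * Complex.exp (-((ε : ℂ) * s))‖) (Set.Ioi 0) :=
    (hf ε (by simpa using hε0)).norm.const_mul _
  refine (hasDerivAt_integral_of_dominated_loc_of_deriv_le
    (F := fun (Z : ℂ) (s : ℝ) => f s * Complex.exp (-(Z * s))) (μ := volume.restrict (Set.Ioi 0))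
    hU ?_ (hf Y hY)
    (F' := fun (Z : ℂ) (s : ℝ) => -(s : ℂ) * (f s * Complex.exp (-(Z * s)))) ?_ ?_ hb ?_).2.differentiableAt
  · filter_upwards [hU] with Z hZ
    exact (hf Z ((by positivity : (0 : ℝ) < 2 * ε).trans hZ)).1
  · exact (Measurable.aestronglyMeasurable (by fun_prop)).mul (hf Y hY).1
  · filter_upwards [self_mem_ae_restrict measurableSet_Ioi] with s hs Z hZ
    have hs0 : (0 : ℝ) < s := hs
    have hZ' : 2 * ε < Z.re := hZ
    rw [norm_mul, norm_mul, norm_mul, norm_neg, Complex.norm_real, Real.norm_eq_abs,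
      abs_of_pos hs0, Complex.norm_exp, Complex.norm_exp]
    have e1 : (-(Z * s)).re = -(Z.re * s) := by simp
    have e2 : (-((ε : ℂ) * s)).re = -(ε * s) := by simp
    rw [e1, e2]
    have h1 : s ≤ ε⁻¹ * Real.exp (ε * s) := by
      rw [← div_eq_inv_mul, le_div_iff₀ hε0]
      linarith [Real.add_one_le_exp (ε * s)]
    have h2 : Real.exp (-(Z.re * s)) ≤ Real.exp (-(2 * ε * s)) := by
      rw [Real.exp_le_exp]; nlinarith
    calc s * (‖f s‖ * Real.exp (-(Z.re * s)))
        ≤ ε⁻¹ * Real.exp (ε * s) * (‖f s‖ * Real.exp (-(2 * ε * s))) := by gcongr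
      _ = ε⁻¹ * (‖f s‖ * (Real.exp (ε * s) * Real.exp (-(2 * ε * s)))) := by ring
      _ = ε⁻¹ * (‖f s‖ * Real.exp (-(ε * s))) := by
          rw [← Real.exp_add]; congr 4; ring
  · refine Eventually.of_forall fun s Z _ => ?_
    have h : HasDerivAt (fun Z : ℂ => -(Z * s)) (-(1 * s)) Z :=
      ((hasDerivAt_id Z).mul_const (s : ℂ)).neg
    refine (h.cexp.const_mul (f s)).congr_deriv ?_
    ring

section Gamma

/-- On a half-line through the origin, `t ^ a e^{-Xt} dt / t` in the coordinate `s = |t|`, with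
`R = X e^{id}`. -/
def gammaIntegrand (a : ℂ) (d : ℝ) (R : ℂ) (s : ℝ) : ℂ :=
  Complex.exp (a * ((Real.log s : ℂ) + (d : ℂ) * Complex.I)) * Complex.exp (-(R * s)) / s

lemma gammaIntegrand_eq (a : ℂ) (d : ℝ) (R : ℂ) {s : ℝ} (hs : 0 < s) :
    gammaIntegrand a d R s =
      Complex.exp (a * (d * Complex.I)) * ((s : ℂ) ^ (a - 1) * Complex.exp (-(R * s))) := by
  have hs0 : (s : ℂ) ≠ 0 := by exact_mod_cast hs.ne'
  rw [gammaIntegrand, Complex.cpow_sub _ _ hs0, Complex.cpow_one, Complex.cpow_def_of_ne_zero hs0,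
    ← Complex.ofReal_log hs.le, mul_add, Complex.exp_add, mul_comm a (Real.log s : ℂ)]
  ring

lemma norm_gammaIntegrand (a : ℂ) (d : ℝ) (R : ℂ) {s : ℝ} (hs : 0 < s) :
    ‖gammaIntegrand a d R s‖ = Real.exp (-(a.im * d)) * (s ^ (a.re - 1) * Real.exp (-(R.re * s))) := by
  rw [gammaIntegrand_eq a d R hs, norm_mul, norm_mul, Complex.norm_exp, Complex.norm_exp,
    Complex.norm_cpow_eq_rpow_re_of_pos hs]
  simp

lemma integrableOn_gammaIntegrand {a R : ℂ} (d : ℝ) (ha : 0 < a.re) (hR : 0 < R.re) :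
    IntegrableOn (gammaIntegrand a d R) (Set.Ioi 0) := by
  have h1 := (integrableOn_rpow_mul_exp_neg_mul_rpow (s := a.re - 1) (p := 1) (by linarith) one_pos
    hR).const_mul (Real.exp (-(a.im * d)))
  refine Integrable.mono' h1 ?_ ?_
  · refine Measurable.aestronglyMeasurable ?_
    unfold gammaIntegrand
    fun_prop
  · filter_upwards [self_mem_ae_restrict measurableSet_Ioi] with s hs
    rw [norm_gammaIntegrand a d R hs, Real.rpow_one, neg_mul]

lemma integral_norm_gammaIntegrand {a R : ℂ} (d : ℝ) (ha : 0 < a.re) (hR : 0 < R.re) :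
    ∫ s in Set.Ioi (0 : ℝ), ‖gammaIntegrand a d R s‖ =
      Real.exp (-(a.im * d)) * ((1 / R.re) ^ a.re * Real.Gamma a.re) := by
  rw [← Real.integral_rpow_mul_exp_neg_mul_Ioi ha hR, ← integral_const_mul]
  exact setIntegral_congr_fun measurableSet_Ioi fun s hs => norm_gammaIntegrand a d R hs

/-- Both sides are holomorphic in `R` and they agree for `R > 0`. -/
lemma integral_cpow_mul_exp_neg_mul_of_re_pos {a R : ℂ} (ha : 0 < a.re) (hR : 0 < R.re) :
    ∫ s in Set.Ioi (0 : ℝ), (s : ℂ) ^ (a - 1) * Complex.exp (-(R * s)) =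
      Complex.exp (-a * Complex.log R) * Complex.Gamma a := by
  have hopen : IsOpen {Y : ℂ | 0 < Y.re} := isOpen_lt continuous_const Complex.continuous_re
  have hint : ∀ Y : ℂ, 0 < Y.re → IntegrableOn
      (fun s : ℝ => (s : ℂ) ^ (a - 1) * Complex.exp (-(Y * s))) (Set.Ioi 0) := by
    intro Y hY
    refine (integrableOn_gammaIntegrand 0 ha hY).congr_fun (fun s hs => ?_) measurableSet_Ioi
    rw [gammaIntegrand_eq a 0 Y hs]
    simp
  have hf : AnalyticOnNhd ℂ (fun Y : ℂ => ∫ s in Set.Ioi (0 : ℝ),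
      (s : ℂ) ^ (a - 1) * Complex.exp (-(Y * s))) {Y | 0 < Y.re} :=
    DifferentiableOn.analyticOnNhd
      (fun Y hY => (differentiableAt_laplace hint hY).differentiableWithinAt) hopen
  have hg : AnalyticOnNhd ℂ (fun Y : ℂ => Complex.exp (-a * Complex.log Y) * Complex.Gamma a)
      {Y | 0 < Y.re} := by
    refine DifferentiableOn.analyticOnNhd (fun Y hY => ?_) hopen
    have : DifferentiableAt ℂ Complex.log Y := Complex.differentiableAt_log (Or.inl hY)
    exact (((this.const_mul (-a)).cexp).mul_const _).differentiableWithinAt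
  have hconv : Convex ℝ {Y : ℂ | 0 < Y.re} := convex_halfSpace_re_gt 0
  refine hf.eqOn_of_preconnected_of_frequently_eq hg hconv.isPreconnected
    (z₀ := 1) (by simp) ?_ hR
  have htend : Tendsto (fun x : ℝ => (x : ℂ)) (𝓝[≠] 1) (𝓝[≠] 1) := by
    refine tendsto_nhdsWithin_iff.2 ⟨?_, ?_⟩
    · have h := Complex.continuous_ofReal.tendsto 1
      rw [Complex.ofReal_one] at h
      exact h.mono_left nhdsWithin_le_nhds
    · filter_upwards [self_mem_nhdsWithin] with x hx
      have : x ≠ 1 := hx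
      simpa using this
  refine htend.frequently (Eventually.frequently ?_)
  filter_upwards [nhdsWithin_le_nhds (lt_mem_nhds one_pos)] with r hr
  rw [Complex.integral_cpow_mul_exp_neg_mul_Ioi ha hr, Complex.cpow_def_of_ne_zero
    (by simpa using hr.ne'), one_div, ← Complex.ofReal_inv, ← Complex.ofReal_log (by positivity),
    Real.log_inv, ← Complex.ofReal_log hr.le]
  congr 2
  push_cast; ring

lemma re_exp_pos {v : ℂ} {d : ℝ} (h0 : -(Real.pi / 2) < v.im + d) (h1 : v.im + d < Real.pi / 2) :
    0 < (Complex.exp (v + d * Complex.I)).re := by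
  rw [Complex.exp_re]
  refine mul_pos (Real.exp_pos _) (Real.cos_pos_of_mem_Ioo ⟨?_, ?_⟩) <;> simpa

/-- The Gamma integral along the half-line of direction `d`, as a function of the logarithm `v`
of the variable. -/
lemma integral_gammaIntegrand {a v : ℂ} {d : ℝ} (ha : 0 < a.re) (h0 : -(Real.pi / 2) < v.im + d)
    (h1 : v.im + d < Real.pi / 2) :
    ∫ s in Set.Ioi (0 : ℝ), gammaIntegrand a d (Complex.exp (v + d * Complex.I)) s =
      Complex.exp (-a * v) * Complex.Gamma a := by
  rw [setIntegral_congr_fun measurableSet_Ioi fun s hs => gammaIntegrand_eq a d _ hs,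
    integral_const_mul, integral_cpow_mul_exp_neg_mul_of_re_pos ha (re_exp_pos h0 h1),
    Complex.log_exp, ← mul_assoc, ← Complex.exp_add]
  · congr 2; ring
  · simp; linarith [Real.pi_pos]
  · simp; linarith [Real.pi_pos]

end Gamma

/-! ### The Laplace integral and its expansion -/

section Expansion

variable {q : ℝ}

/-- The coefficient `q ^ {n(n+1)/2} / (q; q)_n` of `(-x) ^ n` in the expansion of `(q x; q)_∞`. -/
def expansionCoeff (q : ℝ) (n : ℕ) : ℂ := (q : ℂ) ^ (n * (n + 1) / 2) / qPoch (q : ℂ) q n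

lemma hasSum_expansionCoeff (hq0 : 0 < q) (hq1 : q < 1) {x : ℂ} (hx : x ≠ 0) :
    HasSum (fun n : ℕ => (-1) ^ n * expansionCoeff q n * x ^ n) (qPochInf (q * x) q) := by
  have hq : (q : ℂ) ≠ 0 := by exact_mod_cast hq0.ne'
  have h := (summable_eulerCoeff hq0 hq1 (mul_ne_zero hq hx)).hasSum
  rw [← qPochInf_eq_tsum hq0 hq1 (mul_ne_zero hq hx),
    ← Function.Injective.hasSum_iff (g := ((↑) : ℕ → ℤ)) Nat.cast_injective] at h
  · rw [show (fun n : ℕ => (-1) ^ n * expansionCoeff q n * x ^ n) =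
      (fun n : ℤ => eulerCoeff q n * (q * x) ^ n) ∘ ((↑) : ℕ → ℤ) from ?_]
    · exact h
    ext n
    have h1 : ((n * (n + 1) / 2 : ℕ) : ℤ) = (n : ℤ) * (n - 1) / 2 + n := by
      have := triangle_succ n
      push_cast
      rw [← this]
      congr 1; ring
    have h2 : (q : ℂ) ^ (n * (n + 1) / 2) = (q : ℂ) ^ ((n : ℤ) * (n - 1) / 2) * (q : ℂ) ^ n := by
      rw [← zpow_natCast, h1, zpow_add₀ hq, zpow_natCast]
    simp only [Function.comp, eulerCoeff, invPoch_natCast, expansionCoeff, h2, zpow_natCast,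
      mul_pow]
    ring
  · intro n hn
    have : n < 0 := by
      by_contra! h0
      exact hn ⟨n.toNat, by simpa using h0⟩
    rw [eulerCoeff_of_neg this, zero_mul]

lemma expansionCoeff_succ (n : ℕ) : expansionCoeff q (n + 1) =
    expansionCoeff q n * ((q : ℂ) ^ (n + 1) / (1 - (q : ℂ) ^ (n + 1))) := by
  have h1 : (n + 1) * (n + 1 + 1) / 2 = n * (n + 1) / 2 + (n + 1) := by
    rw [show (n + 1) * (n + 1 + 1) = n * (n + 1) + (n + 1) * 2 by ring,
      Nat.add_mul_div_right _ _ two_pos]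
  rw [expansionCoeff, expansionCoeff, h1, pow_add, qPoch, qPoch, Finset.prod_range_succ,
    ← pow_succ', mul_div_mul_comm]

lemma expansionCoeff_ne_zero (hq0 : 0 < q) (hq1 : q < 1) (n : ℕ) : expansionCoeff q n ≠ 0 :=
  div_ne_zero (pow_ne_zero _ (by exact_mod_cast hq0.ne')) (qPoch_self_ne_zero hq0 hq1 n)

/-- The Gaussian decay of the coefficients compensates the growth of the Gamma function. -/
lemma summable_expansionCoeff_mul_Gamma (hq0 : 0 < q) (hq1 : q < 1) {σ ρ : ℝ} (hσ : 0 < σ)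
    (hρ : 0 < ρ) : Summable fun n : ℕ =>
      ‖expansionCoeff q n‖ * ((1 / ρ) ^ (σ + n) * Real.Gamma (σ + n)) := by
  have hpos : ∀ n : ℕ, 0 < ‖expansionCoeff q n‖ * ((1 / ρ) ^ (σ + n) * Real.Gamma (σ + n)) :=
    fun n => mul_pos (norm_pos_iff.2 (expansionCoeff_ne_zero hq0 hq1 n))
      (mul_pos (Real.rpow_pos_of_pos (by positivity) _) (Real.Gamma_pos_of_pos (by positivity)))
  refine summable_of_ratio_test_tendsto_lt_one zero_lt_one
    (Eventually.of_forall fun n => (hpos n).ne') ?_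
  have hpow : Tendsto (fun n : ℕ => q ^ (n + 1)) atTop (𝓝 0) :=
    (tendsto_pow_atTop_nhds_zero_of_lt_one hq0.le hq1).comp (tendsto_add_atTop_nat 1)
  have hnpow : Tendsto (fun n : ℕ => (n : ℝ) * q ^ n) atTop (𝓝 0) :=
    tendsto_self_mul_const_pow_of_lt_one hq0.le hq1
  have hlim : Tendsto (fun n : ℕ => (1 / ρ) * ((σ * q ^ (n + 1) + q * ((n : ℝ) * q ^ n)) /
      (1 - q ^ (n + 1)))) atTop (𝓝 ((1 / ρ) * ((σ * 0 + q * 0) / (1 - 0)))) :=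
    (((hpow.const_mul σ).add (hnpow.const_mul q)).div (tendsto_const_nhds.sub hpow)
      (by norm_num)).const_mul _
  rw [mul_zero, mul_zero, add_zero, zero_div, mul_zero] at hlim
  refine hlim.congr fun n => ?_
  rw [Real.norm_of_nonneg (hpos _).le, Real.norm_of_nonneg (hpos _).le, expansionCoeff_succ,
    norm_mul]
  have hlt : q ^ (n + 1) < 1 := pow_lt_one₀ hq0.le hq1 n.succ_ne_zero
  have h1 : ‖(q : ℂ) ^ (n + 1) / (1 - (q : ℂ) ^ (n + 1))‖ = q ^ (n + 1) / (1 - q ^ (n + 1)) := by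
    have : (q : ℂ) ^ (n + 1) / (1 - (q : ℂ) ^ (n + 1)) =
        ((q ^ (n + 1) / (1 - q ^ (n + 1)) : ℝ) : ℂ) := by push_cast; rfl
    rw [this, Complex.norm_real, Real.norm_of_nonneg]
    exact div_nonneg (by positivity) (by linarith)
  have h2 : Real.Gamma (σ + ((n + 1 : ℕ) : ℝ)) = (σ + n) * Real.Gamma (σ + n) := by
    rw [← Real.Gamma_add_one (by positivity)]; push_cast; ring_nf
  have h3 : (1 / ρ) ^ (σ + ((n + 1 : ℕ) : ℝ)) = (1 / ρ) ^ (σ + n) * (1 / ρ) := by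
    push_cast
    rw [← add_assoc, Real.rpow_add_one (by positivity)]
  have h4 : ‖expansionCoeff q n‖ ≠ 0 := norm_ne_zero_iff.2 (expansionCoeff_ne_zero hq0 hq1 n)
  have h5 : (1 / ρ) ^ (σ + (n : ℝ)) ≠ 0 := (Real.rpow_pos_of_pos (by positivity) _).ne'
  have h6 : Real.Gamma (σ + n) ≠ 0 := (Real.Gamma_pos_of_pos (by positivity)).ne'
  rw [h1, h2, h3]
  generalize (1 / ρ) ^ (σ + (n : ℝ)) = P at h5 ⊢
  have h7 : 1 - q ^ (n + 1) ≠ 0 := by linarith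
  field_simp
  ring

lemma connectionConst_ne_zero (hq0 : 0 < q) (hq1 : q < 1) {mu : ℂ}
    (hmu : ∀ k : ℤ, (q : ℂ) ^ mu ≠ (q : ℂ) ^ k) : connectionConst q mu ≠ 0 := by
  have hq : (q : ℂ) ≠ 0 := by exact_mod_cast hq0.ne'
  have hk : (kappa q : ℂ) ≠ 0 := by exact_mod_cast (kappa_pos hq0 hq1).ne'
  refine div_ne_zero (mul_ne_zero hk (mul_ne_zero ?_ ?_))
    (mul_ne_zero Complex.I_ne_zero (qPochInf_self_ne_zero hq0 hq1))
  · refine qPochInf_ne_zero hq0 hq1 fun j hj => hmu (-j) ?_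
    rw [zpow_neg, zpow_natCast]
    exact eq_inv_of_mul_eq_one_left hj
  · refine qPochInf_ne_zero hq0 hq1 fun j hj => hmu (j + 1) ?_
    have hα : (q : ℂ) ^ mu ≠ 0 := by simp [hq]
    rw [Complex.cpow_sub _ _ hq, Complex.cpow_one] at hj
    rw [zpow_add_one₀ hq, zpow_natCast]
    field_simp at hj
    rw [← hj]; ring

/-- The integrand of the Laplace integral, without its exponential factor. -/
def laplaceKernel (q : ℝ) (nu a : ℂ) (d s : ℝ) : ℂ :=
  theta q (-a / (s * Complex.exp (d * Complex.I))) /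
    qPochInf (1 / (s * Complex.exp (d * Complex.I))) q *
    Complex.exp (nu * ((Real.log s : ℂ) + (d : ℂ) * Complex.I)) / s

lemma laplaceIntegrand_eq (nu a : ℂ) (d : ℝ) (x : LogSurface) (s : ℝ) :
    laplaceIntegrand q nu a d x s = laplaceKernel q nu a d s *
      Complex.exp (-(Complex.exp (x.log + d * Complex.I) * s)) := by
  rw [laplaceIntegrand, laplaceKernel, Complex.exp_add, LogSurface.toComplex,
    show -Complex.exp x.log * (s * Complex.exp (d * Complex.I)) =
      -(Complex.exp x.log * Complex.exp (d * Complex.I) * s) by ring]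
  ring

/-- The exponent `n + ν + μ + κil` of `t` in the term of index `(n, l)` of the expansion of the
kernel. -/
def termExponent (q : ℝ) (mu nu : ℂ) (p : ℕ × ℤ) : ℂ :=
  (p.1 : ℂ) + nu + mu + (kappa q : ℂ) * Complex.I * (p.2 : ℂ)

/-- The coefficient of the term of index `(n, l)` of the expansion of the kernel. -/
def termCoeff (q : ℝ) (mu : ℂ) (p : ℕ × ℤ) : ℂ :=
  connectionConst q mu * ((-1) ^ p.1 * expansionCoeff q p.1 *
    kroneckerCoeff (dualBase q) (Complex.exp (2 * Real.pi * Complex.I * mu)) p.2)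

lemma termExponent_re (mu nu : ℂ) (p : ℕ × ℤ) :
    (termExponent q mu nu p).re = (mu + nu).re + p.1 := by
  simp [termExponent]; ring

lemma termExponent_im (mu nu : ℂ) (p : ℕ × ℤ) :
    (termExponent q mu nu p).im = (mu + nu).im + kappa q * p.2 := by
  simp [termExponent]; ring

lemma hasSum_mul_prod {ι κ : Type*} {F : ι → ℂ} {G : κ → ℂ} {a b : ℂ} (hF : HasSum F a)
    (hG : HasSum G b) : HasSum (fun p : ι × κ => F p.1 * G p.2) (a * b) :=
  hF.mul hG (summable_mul_of_summable_norm hF.summable.norm hG.summable.norm)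

lemma exp_termExponent_mul (mu nu w : ℂ) (p : ℕ × ℤ) :
    Complex.exp (termExponent q mu nu p * w) = Complex.exp w ^ p.1 *
      Complex.exp (nu * w) * Complex.exp (mu * w) *
      Complex.exp (kappa q * Complex.I * w) ^ p.2 := by
  rw [← Complex.exp_nat_mul, ← Complex.exp_int_mul, ← Complex.exp_add, ← Complex.exp_add,
    ← Complex.exp_add, termExponent]
  congr 1; ring

lemma hasSum_laplaceKernel (hq0 : 0 < q) (hq1 : q < 1) {mu : ℂ} (nu : ℂ)
    (hmu : ∀ k : ℤ, (q : ℂ) ^ mu ≠ (q : ℂ) ^ k) {d : ℝ} (hd : d ∈ Set.Ioo 0 (2 * Real.pi))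
    (R : ℂ) {s : ℝ} (hs : 0 < s) :
    HasSum (fun p => termCoeff q mu p * gammaIntegrand (termExponent q mu nu p) d R s)
      (laplaceKernel q nu ((q : ℂ) ^ mu) d s * Complex.exp (-(R * s))) := by
  set w : ℂ := (Real.log s : ℂ) + (d : ℂ) * Complex.I with hw
  have him : w.im = d := by simp [hw]
  have ht : (s : ℂ) * Complex.exp (d * Complex.I) = Complex.exp w := by
    rw [hw, Complex.exp_add, ← Complex.ofReal_exp, Real.exp_log hs]
  have h0 : 0 < w.im := him ▸ hd.1
  have h1 : w.im < 2 * Real.pi := him ▸ hd.2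
  have key := theta_div_qPochInf hq0 hq1 hmu h0 h1
  have hS := summable_kronecker (dualBase_pos q) (dualBase_lt_one hq0 hq1)
    (Complex.exp_ne_zero (2 * Real.pi * Complex.I * mu)) (dualBase_lt_norm hq0 hq1 h1)
    (norm_exp_kappa_lt_one hq0 hq1 h0)
  have hP := hasSum_expansionCoeff hq0 hq1 (Complex.exp_ne_zero w)
  have hprod := (hasSum_mul_prod hP hS.hasSum).mul_left
    (connectionConst q mu * Complex.exp (mu * w) * (Complex.exp (nu * w) *
      Complex.exp (-(R * s)) / s))
  have hval : laplaceKernel q nu ((q : ℂ) ^ mu) d s * Complex.exp (-(R * s)) =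
      connectionConst q mu * Complex.exp (mu * w) * (Complex.exp (nu * w) *
        Complex.exp (-(R * s)) / s) * (qPochInf (q * Complex.exp w) q *
        kroneckerSeries (dualBase q) (Complex.exp (2 * Real.pi * Complex.I * mu))
          (Complex.exp (kappa q * Complex.I * w))) := by
    rw [laplaceKernel, ht, ← hw, one_div, ← Complex.exp_neg, neg_div,
      div_eq_mul_inv _ (Complex.exp w), ← Complex.exp_neg, key]
    ring
  rw [hval]
  refine hprod.congr_fun fun p => ?_
  rw [gammaIntegrand, ← hw, exp_termExponent_mul, termCoeff]
  ring

/-- Absolute convergence of the Laplace integral, and its expansion by integration term by term.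
The terms of the expansion depend on `d` only through the condition on the logarithm `v` of
the variable. -/
theorem integrableOn_and_hasSum_laplace (hq0 : 0 < q) (hq1 : q < 1) {mu nu : ℂ}
    (hre : 0 < (mu + nu).re) (hmu : ∀ k : ℤ, (q : ℂ) ^ mu ≠ (q : ℂ) ^ k) {d : ℝ}
    (hd : d ∈ Set.Ioo 0 (2 * Real.pi)) {v : ℂ} (h0 : -(Real.pi / 2) < v.im + d)
    (h1 : v.im + d < Real.pi / 2) :
    IntegrableOn (fun s : ℝ => laplaceKernel q nu ((q : ℂ) ^ mu) d s *
      Complex.exp (-(Complex.exp (v + d * Complex.I) * s))) (Set.Ioi 0) ∧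
    HasSum (fun p => termCoeff q mu p * (Complex.exp (-termExponent q mu nu p * v) *
        Complex.Gamma (termExponent q mu nu p)))
      (∫ s in Set.Ioi (0 : ℝ), laplaceKernel q nu ((q : ℂ) ^ mu) d s *
        Complex.exp (-(Complex.exp (v + d * Complex.I) * s))) := by
  set R := Complex.exp (v + d * Complex.I) with hR
  have hR0 : 0 < R.re := re_exp_pos h0 h1
  have ha : ∀ p, 0 < (termExponent q mu nu p).re := fun p => by
    rw [termExponent_re]; positivity
  have hint : ∀ p, IntegrableOn (fun s : ℝ =>
      termCoeff q mu p * gammaIntegrand (termExponent q mu nu p) d R s) (Set.Ioi 0) := fun p =>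
    (integrableOn_gammaIntegrand d (ha p) hR0).const_mul _
  have him : ((d : ℂ) * Complex.I).im = d := by simp
  have hS := summable_kronecker (dualBase_pos q) (dualBase_lt_one hq0 hq1)
    (Complex.exp_ne_zero (2 * Real.pi * Complex.I * mu))
    (dualBase_lt_norm hq0 hq1 (w := d * Complex.I) (by rw [him]; exact hd.2))
    (norm_exp_kappa_lt_one hq0 hq1 (w := d * Complex.I) (by rw [him]; exact hd.1))
  have hsum : Summable fun p => ∫ s in Set.Ioi (0 : ℝ),
      ‖termCoeff q mu p * gammaIntegrand (termExponent q mu nu p) d R s‖ := by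
    have hG := summable_expansionCoeff_mul_Gamma hq0 hq1 hre hR0
    have hprod := (hG.mul_of_nonneg hS.norm (fun n => mul_nonneg (norm_nonneg _)
      (mul_nonneg (Real.rpow_nonneg (by positivity) _) (Real.Gamma_nonneg_of_nonneg
        (by positivity)))) (fun l => norm_nonneg _)).mul_left
      (‖connectionConst q mu‖ * Real.exp (-((mu + nu).im * d)))
    refine hprod.congr fun p => ?_
    simp only [norm_mul]
    rw [integral_const_mul, integral_norm_gammaIntegrand d (ha p) hR0, termExponent_re,
      termExponent_im, termCoeff, norm_zpow, norm_exp_kappa, him, ← Real.rpow_intCast, ← Real.exp_mul,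
      show -(((mu + nu).im + kappa q * p.2) * d) = -((mu + nu).im * d) +
        -(kappa q * d) * p.2 by ring, Real.exp_add]
    simp only [norm_mul, norm_pow, norm_neg, norm_one, one_pow, one_mul]
    ring
  have hmain := integrable_and_hasSum_integral (m := volume.restrict (Set.Ioi (0 : ℝ))) hint hsum
    (f := fun s : ℝ => laplaceKernel q nu ((q : ℂ) ^ mu) d s * Complex.exp (-(R * s))) (by
      filter_upwards [self_mem_ae_restrict measurableSet_Ioi] with s hs
      exact hasSum_laplaceKernel hq0 hq1 nu hmu hd R hs)
  refine ⟨hmain.1, hmain.2.congr_fun fun p => ?_⟩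
  rw [integral_const_mul, hR, integral_gammaIntegrand (ha p) h0 h1]

lemma hasSum_laplaceDir (hq0 : 0 < q) (hq1 : q < 1) {mu nu : ℂ}
    (hre : 0 < (mu + nu).re) (hmu : ∀ k : ℤ, (q : ℂ) ^ mu ≠ (q : ℂ) ^ k) {d : ℝ}
    (hd : d ∈ Set.Ioo 0 (2 * Real.pi)) {x : LogSurface}
    (hx : x ∈ LogSurface.sector (-d - Real.pi / 2) (-d + Real.pi / 2)) :
    HasSum (fun p => termCoeff q mu p * (Complex.exp (-termExponent q mu nu p * x.log) *
        Complex.Gamma (termExponent q mu nu p))) (laplaceDir q nu ((q : ℂ) ^ mu) d x) := by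
  have him : x.log.im = x.arg := by simp [LogSurface.log]
  simp only [laplaceDir, laplaceIntegrand_eq]
  exact (integrableOn_and_hasSum_laplace hq0 hq1 hre hmu hd (by rw [him]; linarith [hx.1])
    (by rw [him]; linarith [hx.2])).2

lemma integrableOn_laplaceIntegrand (hq0 : 0 < q) (hq1 : q < 1) {mu nu : ℂ}
    (hre : 0 < (mu + nu).re) (hmu : ∀ k : ℤ, (q : ℂ) ^ mu ≠ (q : ℂ) ^ k) {d : ℝ}
    (hd : d ∈ Set.Ioo 0 (2 * Real.pi)) {x : LogSurface}
    (hx : x ∈ LogSurface.sector (-d - Real.pi / 2) (-d + Real.pi / 2)) :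
    IntegrableOn (laplaceIntegrand q nu ((q : ℂ) ^ mu) d x) (Set.Ioi 0) := by
  have him : x.log.im = x.arg := by simp [LogSurface.log]
  rw [funext fun s => laplaceIntegrand_eq (q := q) nu ((q : ℂ) ^ mu) d x s]
  exact (integrableOn_and_hasSum_laplace hq0 hq1 hre hmu hd (by rw [him]; linarith [hx.1])
    (by rw [him]; linarith [hx.2])).1

lemma sector_subset {d : ℝ} (hd : d ∈ Set.Ioo 0 (2 * Real.pi)) :
    LogSurface.sector (-d - Real.pi / 2) (-d + Real.pi / 2) ⊆
      LogSurface.sector (-(5 * Real.pi / 2)) (Real.pi / 2) := fun x hx =>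
  ⟨by linarith [hx.1, hd.2], by linarith [hx.2, hd.1]⟩

/-- All the Laplace integrals at `x` have the same expansion, hence the same value. -/
lemma laplaceI_eq_laplaceDir (hq0 : 0 < q) (hq1 : q < 1) {mu nu : ℂ}
    (hre : 0 < (mu + nu).re) (hmu : ∀ k : ℤ, (q : ℂ) ^ mu ≠ (q : ℂ) ^ k) {d : ℝ}
    (hd : d ∈ Set.Ioo 0 (2 * Real.pi)) {x : LogSurface}
    (hx : x ∈ LogSurface.sector (-d - Real.pi / 2) (-d + Real.pi / 2)) :
    laplaceI q nu ((q : ℂ) ^ mu) x = laplaceDir q nu ((q : ℂ) ^ mu) d x := by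
  have h := directionOf_spec (sector_subset hd hx)
  exact (hasSum_laplaceDir hq0 hq1 hre hmu h.1 h.2).unique
    (hasSum_laplaceDir hq0 hq1 hre hmu hd hx)

lemma analyticOnNhd_laplaceI (hq0 : 0 < q) (hq1 : q < 1) {mu nu : ℂ}
    (hre : 0 < (mu + nu).re) (hmu : ∀ k : ℤ, (q : ℂ) ^ mu ≠ (q : ℂ) ^ k) :
    AnalyticOnNhd ℂ (fun w : ℂ => laplaceI q nu ((q : ℂ) ^ mu) (LogSurface.ofLog w))
      {w : ℂ | -(5 * Real.pi / 2) < w.im ∧ w.im < Real.pi / 2} := by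
  have hopen : ∀ a b : ℝ, IsOpen {w : ℂ | a < w.im ∧ w.im < b} := fun a b =>
    (isOpen_lt continuous_const Complex.continuous_im).inter
      (isOpen_lt Complex.continuous_im continuous_const)
  refine DifferentiableOn.analyticOnNhd (fun w hw => ?_) (hopen _ _)
  obtain ⟨hd, hwd⟩ := directionOf_spec (x := LogSurface.ofLog w) hw
  set d := directionOf (LogSurface.ofLog w) with hdef
  have hint : ∀ Y : ℂ, 0 < Y.re → IntegrableOn (fun s : ℝ =>
      laplaceKernel q nu ((q : ℂ) ^ mu) d s * Complex.exp (-(Y * s))) (Set.Ioi 0) := by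
    intro Y hY
    have hY0 : Y ≠ 0 := fun h => by simp [h] at hY
    have harg := Complex.abs_arg_lt_pi_div_two_iff.2 (Or.inl hY)
    rw [abs_lt] at harg
    have h := (integrableOn_and_hasSum_laplace hq0 hq1 hre hmu hd
      (v := Complex.log Y - d * Complex.I) (by simpa [Complex.log_im] using harg.1)
      (by simpa [Complex.log_im] using harg.2)).1
    rwa [sub_add_cancel, Complex.exp_log hY0] at h
  have hR : 0 < (Complex.exp (w + d * Complex.I)).re :=
    re_exp_pos (by linarith [show -d - Real.pi / 2 < w.im from hwd.1])
      (by linarith [show w.im < -d + Real.pi / 2 from hwd.2])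
  have hdiff : DifferentiableAt ℂ (fun w : ℂ => ∫ s in Set.Ioi (0 : ℝ),
      laplaceKernel q nu ((q : ℂ) ^ mu) d s *
        Complex.exp (-(Complex.exp (w + d * Complex.I) * s))) w :=
    (differentiableAt_laplace hint hR).comp w (f := fun w => Complex.exp (w + d * Complex.I))
      (by fun_prop)
  refine (hdiff.congr_of_eventuallyEq ?_).differentiableWithinAt
  filter_upwards [(hopen (-d - Real.pi / 2) (-d + Real.pi / 2)).mem_nhds hwd] with z hz
  rw [laplaceI_eq_laplaceDir hq0 hq1 hre hmu hd (x := LogSurface.ofLog z) hz]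
  simp only [laplaceDir, laplaceIntegrand_eq, LogSurface.log_ofLog]

/-- The term of index `(n, l)` of the expansion, in terms of the modular variable. -/
lemma term_eq_PhiTerm (hq0 : 0 < q) (hq1 : q < 1) (mu nu : ℂ) (x : LogSurface) (p : ℕ × ℤ) :
    termCoeff q mu p * (Complex.exp (-termExponent q mu nu p * x.log) *
        Complex.Gamma (termExponent q mu nu p)) =
      connectionConst q mu * x.inv.cpow nu * (expansionCoeff q p.1 *
        (modularVar q x).cpow (-(mu * Complex.I) / (kappa q : ℂ)) * (-1 / x.toComplex) ^ p.1) *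
        PhiTerm ((p.1 : ℂ) + nu) mu q (modularVar q x) p.2 := by
  have hk : (kappa q : ℂ) ≠ 0 := by exact_mod_cast (kappa_pos hq0 hq1).ne'
  have hinv : x.inv.log = -x.log := by
    simp only [LogSurface.log, LogSurface.inv, Real.log_inv]
    push_cast; ring
  have h1 : (modularVar q x).cpow (-(mu * Complex.I) / (kappa q : ℂ)) =
      Complex.exp (-mu * x.log) := by
    rw [LogSurface.cpow, modularVar, LogSurface.log_ofLog]
    congr 1
    field_simp
    linear_combination (mu * x.log) * Complex.I_sq
  have h2 : (modularVar q x).toComplex ^ p.2 =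
      Complex.exp (p.2 * (-(kappa q * Complex.I) * x.log)) := by
    rw [LogSurface.toComplex, modularVar, LogSurface.log_ofLog, Complex.exp_int_mul]
  have h3 : (-1 / x.toComplex) ^ p.1 = (-1) ^ p.1 * Complex.exp (p.1 * -x.log) := by
    rw [LogSurface.toComplex, div_eq_mul_inv, mul_pow, ← Complex.exp_neg, Complex.exp_nat_mul]
  have h4 : Complex.exp (-termExponent q mu nu p * x.log) = Complex.exp (nu * -x.log) *
      Complex.exp (-mu * x.log) * Complex.exp (p.1 * -x.log) *
      Complex.exp (p.2 * (-(kappa q * Complex.I) * x.log)) := by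
    rw [← Complex.exp_add, ← Complex.exp_add, ← Complex.exp_add, termExponent]
    congr 1; ring
  rw [PhiTerm, h1, h2, h3, h4, LogSurface.cpow, hinv, termCoeff, kroneckerCoeff,
    exp_mul_dualBase_zpow, termExponent]
  ring

lemma expansion_laplaceI (hq0 : 0 < q) (hq1 : q < 1) {mu nu : ℂ}
    (hre : 0 < (mu + nu).re) (hmu : ∀ k : ℤ, (q : ℂ) ^ mu ≠ (q : ℂ) ^ k) {x : LogSurface}
    (hx : x ∈ LogSurface.sector (-(5 * Real.pi / 2)) (Real.pi / 2)) :
    (∀ n : ℕ, Summable (PhiTerm ((n : ℂ) + nu) mu q (modularVar q x))) ∧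
      Summable (expansionTerm q mu nu x) ∧
      laplaceI q nu ((q : ℂ) ^ mu) x =
        connectionConst q mu * x.inv.cpow nu * ∑' n : ℕ, expansionTerm q mu nu x n := by
  obtain ⟨hd, hxd⟩ := directionOf_spec hx
  have h := hasSum_laplaceDir hq0 hq1 hre hmu hd hxd
  rw [funext (term_eq_PhiTerm hq0 hq1 mu nu x)] at h
  have hc : connectionConst q mu * x.inv.cpow nu ≠ 0 :=
    mul_ne_zero (connectionConst_ne_zero hq0 hq1 hmu) (Complex.exp_ne_zero _)
  have hn : ∀ n : ℕ, connectionConst q mu * x.inv.cpow nu * (expansionCoeff q n *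
      (modularVar q x).cpow (-(mu * Complex.I) / (kappa q : ℂ)) * (-1 / x.toComplex) ^ n) ≠ 0 :=
    fun n => mul_ne_zero hc (mul_ne_zero (mul_ne_zero (expansionCoeff_ne_zero hq0 hq1 n)
      (Complex.exp_ne_zero _)) (pow_ne_zero n (div_ne_zero (by norm_num) (Complex.exp_ne_zero _))))
  have hPhi : ∀ n : ℕ, Summable (PhiTerm ((n : ℂ) + nu) mu q (modularVar q x)) := fun n =>
    (summable_mul_left_iff (hn n)).1 (h.summable.prod_factor n)
  have hsum : HasSum (fun n => connectionConst q mu * x.inv.cpow nu * expansionTerm q mu nu x n)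
      (laplaceI q nu ((q : ℂ) ^ mu) x) := by
    refine h.prod_fiberwise fun n => ?_
    have h2 := (hPhi n).hasSum.mul_left (connectionConst q mu * x.inv.cpow nu *
      (expansionCoeff q n * (modularVar q x).cpow (-(mu * Complex.I) / (kappa q : ℂ)) *
        (-1 / x.toComplex) ^ n))
    have h3 : expansionTerm q mu nu x n = expansionCoeff q n *
        ((modularVar q x).cpow (-(mu * Complex.I) / (kappa q : ℂ)) *
          ∑' l, PhiTerm ((n : ℂ) + nu) mu q (modularVar q x) l) * (-1 / x.toComplex) ^ n := rfl
    rw [h3, show ∀ c e P T X : ℂ, c * (e * (P * T) * X) = c * (e * P * X) * T from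
      fun c e P T X => by ring]
    exact h2
  have hexp := (summable_mul_left_iff hc).1 hsum.summable
  exact ⟨hPhi, hexp, by rw [← hsum.tsum_eq, tsum_mul_left]⟩

end Expansion

end QLaplace

end

theorem theorem5p2 (q : ℝ) (hq0 : 0 < q) (hq1 : q < 1) (mu nu : ℂ)
    (hre : 0 < (mu + nu).re) (hmu : ∀ k : ℤ, (q : ℂ) ^ mu ≠ (q : ℂ) ^ k) :
    -- the Laplace integrals converge, in every direction `d`
    (∀ d ∈ Set.Ioo (0 : ℝ) (2 * Real.pi),
      ∀ x ∈ QLaplace.LogSurface.sector (-d - Real.pi / 2) (-d + Real.pi / 2),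
        IntegrableOn (QLaplace.laplaceIntegrand q nu ((q : ℂ) ^ mu) d x) (Set.Ioi 0)) ∧
    -- `I_ν` extends all of them
    (∀ d ∈ Set.Ioo (0 : ℝ) (2 * Real.pi),
      ∀ x ∈ QLaplace.LogSurface.sector (-d - Real.pi / 2) (-d + Real.pi / 2),
        QLaplace.laplaceI q nu ((q : ℂ) ^ mu) x =
          QLaplace.laplaceDir q nu ((q : ℂ) ^ mu) d x) ∧
    -- `I_ν` is analytic on the sector `S(-5π/2, π/2)`, in the chart `w = log x`
    AnalyticOnNhd ℂ
      (fun w : ℂ => QLaplace.laplaceI q nu ((q : ℂ) ^ mu) (QLaplace.LogSurface.ofLog w))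
      {w : ℂ | -(5 * Real.pi / 2) < w.im ∧ w.im < Real.pi / 2} ∧
    -- the expansion, with the convergence of all the series in it
    (∀ x ∈ QLaplace.LogSurface.sector (-(5 * Real.pi / 2)) (Real.pi / 2),
      (∀ n : ℕ, Summable
        (QLaplace.PhiTerm ((n : ℂ) + nu) mu q (QLaplace.modularVar q x))) ∧
      Summable (QLaplace.expansionTerm q mu nu x) ∧
      QLaplace.laplaceI q nu ((q : ℂ) ^ mu) x =
        QLaplace.connectionConst q mu * x.inv.cpow nu *
          ∑' n : ℕ, QLaplace.expansionTerm q mu nu x n) := by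
  exact ⟨fun d hd x hx => QLaplace.integrableOn_laplaceIntegrand hq0 hq1 hre hmu hd hx,
    fun d hd x hx => QLaplace.laplaceI_eq_laplaceDir hq0 hq1 hre hmu hd hx,
    QLaplace.analyticOnNhd_laplaceI hq0 hq1 hre hmu,
    fun x hx => QLaplace.expansion_laplaceI hq0 hq1 hre hmu hx⟩
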